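/- **Notation.** Let $\varphi_{t,f}$ denote the time-$t$ flow map of $y'=f(y)$. A *consistent one-step integrator* on a finite-dimensional real normed space $E$ (e.g. $\mathbb R^D$ or $\mathbb C^D$) assigns to a step $h\in\mathbb R$, a vector field $g$ and a point $y$ a value $\Phi_{h,g}(y)$ such that, wherever $g=g_\varepsilon(y)$ is smooth in $y$ and in finitely many real parameters $\varepsilon$, $\Phi_{h,g_\varepsilon}(y)$ is smooth in $(h,\varepsilon,y)$ near $h=0$, and $\Phi_{h,g}(y)=y+h\,g(y)+O(h^2)$. A *Runge–Kutta method* with real coefficients $a_{ij},b_i$ ($1\le i,j\le s$) is $\Phi_{h,g}(y)=y+h\sum_i b_i g(v_i)$ with $v_i=y+h\sum_j a_{ij}g(v_j)$ (for implicit methods: the solution that is the limit of the fixed-point iteration started at $v_i=y$, which for small $h$ is the solution near $y$); it is *consistent* if $\sum_i b_i=1$. The *inverse modified differential equation* (IMDE) of $\Phi$ for a smooth vector field $f$ on an open set $U\subseteq E$ is $\tilde y'=f_h(\tilde y)$ with a formal series $f_h=f_0+hf_1+h^2f_2+\cdots$, $f_k$ smooth on $U$, such that $\Phi_{h,f_h}(y)=\varphi_{h,f}(y)$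 for all $y\in U$ as formal power series in $h$; that is, with $f_h^K=\sum_{k=0}^K h^kf_k$, $\Phi_{h,f_h^K}(y)=\varphi_{h,f}(y)+O(h^{K+2})$ as $h\to0^+$ for every $K\ge0$ and $y\in U$. **Theorem 3.2.** 1. Let $\Phi$ be a consistent one-step integrator on $E$, $U\subseteq E$ open, $f$ a smooth vector field on $U$ and $p\ge1$, and suppose that for every $y\in U$ $$\Phi_{h,f}(y)=\varphi_{h,f}(y)+h^{p+1}\delta_f(y)+O(h^{p+2})\qquad(h\to0^+).$$ Then the IMDE of $\Phi$ for $f$ on $U$ exists and satisfies $f_0=f$, $f_k=0$ for $1\le k<p$, and $f_p=-\delta_f$ on $U$, i.e. $f_h=f-h^p\delta_f+\cdots$; in particular $f_h^K(y)=f(y)+O(h^p)$ for all $K$ and all $y\in U$. 2. Every consistent Runge–Kutta method is a consistent one-step integrator, so 1. applies to it. 3. Let $\Phi$ be a consistent Runge–Kutta method and let $p\ge 1$, $S\ge1$ be integers and $\rho_1,\rho_2>0$. There are constants $T_0>0$ and $c_2>0$, depending only on $\Phi$, $p$, $S$, $\rho_1$, $\rho_2$, such that the following holds for every dimension $D$,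 every $x\in\mathbb R^D$ and all $r_1,r_2,m>0$ with $r_1/m=\rho_1$, $r_2/m=\rho_2$. With $\|\cdot\|$ the maximum norm on $\mathbb C^D$ and $\mathcal B(x,r)$ the ball of radius $r$ in $\mathbb C^D$, let $f$ and $f_\theta$ be $\mathbb C^D$-valued, analytic and bounded by $m$ on $\mathcal B(x,r_1+r_2)$, and suppose that $\Phi_{h,f}(y)=\varphi_{h,f}(y)+h^{p+1}\delta_f(y)+O(h^{p+2})$ as $h\to0^+$ for every $y\in\mathcal B(x,r_1+r_2)$. If $0<T<T_0$ and $h=T/S$, then $$\mathcal L=\frac1{Sh}\,\sup_{y\in\mathcal B(x,r_1)}\big\|(\Phi_{h,f_\theta})^S(y)-\varphi_{Sh,f}(y)\big\|$$ is finite and $$\|f_\theta(x)-f(x)\|\le c_2\,m\,h^p+\frac{e}{e-1}\,\mathcal L .$$ -/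

import Mathlib

open Set Filter Topology Asymptotics
open scoped ContDiff

/-- A one-step method on `E`: it sends a step size `h`, a vector field `g` and an initial value `y`
to the numerical value `Φ_{h,g}(y)`. -/
abbrev OneStepMethod (E : Type*) := ℝ → (E → E) → E → E

open Classical in
/-- The time-`t` flow map `φ_{t,f}` of `y' = f(y)` for `t ≥ 0`: `flow f t y` is the value at time `t`
of a solution on `[0, t]` starting at `y`. (If there is no solution on `[0, t]`, the value is the
irrelevant default `y`. Where `f` is `C¹` along the solution, the solution is unique.) -/
noncomputable def flow {E : Type*} [NormedAddCommGroup E] [NormedSpace ℝ E]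
    (f : E → E) (t : ℝ) (y : E) : E :=
  if hγ : ∃ γ : ℝ → E, γ 0 = y ∧ IsIntegralCurveOn γ (fun _ => f) (Icc 0 t) then
    hγ.choose t
  else y

/-- Consistent one-step integrators. The value `Φ_{h,g}(y)` depends smoothly on the step `h` near
`h = 0`, on the initial value `y`, and on finitely many real parameters `ε` on which the vector field
`g = g_ε` may depend smoothly; and its expansion in `h` starts with
`Φ_{h,g}(y) = y + h g(y) + O(h²)`. -/
structure IsConsistentIntegrator {E : Type*} [NormedAddCommGroup E] [NormedSpace ℝ E]
    (Φ : OneStepMethod E) : Prop where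
  smooth : ∀ (q : ℕ) (g : (Fin q → ℝ) → E → E) (ε₀ : Fin q → ℝ) (y₀ : E),
    ContDiffAt ℝ ∞ (fun z : (Fin q → ℝ) × E => g z.1 z.2) (ε₀, y₀) →
    ContDiffAt ℝ ∞ (fun z : ℝ × (Fin q → ℝ) × E => Φ z.1 (g z.2.1) z.2.2) (0, ε₀, y₀)
  zero_step : ∀ (g : E → E) (y : E), ContDiffAt ℝ ∞ g y → Φ 0 g y = y
  consistent : ∀ (g : E → E) (y : E), ContDiffAt ℝ ∞ g y →
    HasDerivAt (fun h : ℝ => Φ h g y) (g y) 0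

/-- Applied to `f`, the method has order (at least) `p` on `U`, and `h^(p+1) δ(y)` is the leading
term of its local truncation error:
`Φ_{h,f}(y) = φ_{h,f}(y) + h^(p+1) δ(y) + O(h^(p+2))` as `h → 0⁺`, at every `y ∈ U`. -/
def HasLocalError {E : Type*} [NormedAddCommGroup E] [NormedSpace ℝ E]
    (Φ : OneStepMethod E) (f : E → E) (U : Set E) (p : ℕ) (δ : E → E) : Prop :=
  ∀ y ∈ U, (fun h : ℝ => Φ h f y - (flow f h y + h ^ (p + 1) • δ y))
    =O[𝓝[>] (0 : ℝ)] (fun h : ℝ => h ^ (p + 2))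

/-- The truncated vector field `f_h^K(y) = ∑_{k ≤ K} h^k f_k(y)` of a formal series
`f_h = f_0 + h f_1 + h² f_2 + ⋯`. -/
noncomputable def truncField {E : Type*} [NormedAddCommGroup E] [NormedSpace ℝ E]
    (F : ℕ → E → E) (K : ℕ) (h : ℝ) (y : E) : E :=
  ∑ k ∈ Finset.range (K + 1), h ^ k • F k y

/-- The formal series `f_h = F 0 + h F 1 + h² F 2 + ⋯` with smooth coefficients on `U` is the inverse
modified differential equation (IMDE) of the integrator `Φ` for the vector field `f` on `U`:
`Φ_{h,f_h}(y) = φ_{h,f}(y)` at every `y ∈ U`, in the sense of formal power series in `h`.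
As `Φ_{h,g}(y) = y + h g(y) + O(h²)`, the field `F k` enters the expansion of `Φ_{h,f_h}(y)` only from
the power `h^(k+1)` on. So the coefficients of `h^0, …, h^(K+1)` of the formal series `Φ_{h,f_h}(y)`
are those of `Φ_{h,f_h^K}(y)`, and the two formal series coincide term by term iff, for every `K`,
`Φ_{h,f_h^K}(y)` and `φ_{h,f}(y)` have the same Taylor expansion up to `O(h^(K+2))`. -/
structure IsIMDE {E : Type*} [NormedAddCommGroup E] [NormedSpace ℝ E]
    (Φ : OneStepMethod E) (f : E → E) (U : Set E) (F : ℕ → E → E) : Prop where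
  smooth : ∀ k, ContDiffOn ℝ ∞ (F k) U
  formal_eq : ∀ K : ℕ, ∀ y ∈ U,
    (fun h : ℝ => Φ h (truncField F K h) y - flow f h y)
      =O[𝓝[>] (0 : ℝ)] (fun h : ℝ => h ^ (K + 2))

/-- The coefficients of a Runge–Kutta method with `s` stages, explicit or implicit. -/
structure RungeKutta (s : ℕ) where
  a : Fin s → Fin s → ℝ
  b : Fin s → ℝ

namespace RungeKutta

variable {s : ℕ} {E : Type*} [NormedAddCommGroup E] [NormedSpace ℝ E]

/-- The right-hand side of the stage equations, `v ↦ (y + h ∑ j, a i j • g (v j))_i`. -/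
noncomputable def stageMap (M : RungeKutta s) (h : ℝ) (g : E → E) (y : E) (v : Fin s → E) :
    Fin s → E :=
  fun i => y + h • ∑ j, M.a i j • g (v j)

open Classical in
/-- The stages `v i = y + h ∑ j, a i j • g (v j)`. For an implicit method these equations may have
several solutions; the stages are the solution that is the limit of the fixed-point iteration started
at `v i = y`. For small `h` this is the unique solution near `y`, the one given by the implicit
function theorem; for an explicit method the iteration always stops at the only solution. (If there
is no such solution, the value is the irrelevant default `v i = y`.) -/
noncomputable def stages (M : RungeKutta s) (h : ℝ) (g : E → E) (y : E) : Fin s → E :=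
  if hv : ∃ v : Fin s → E, v = M.stageMap h g y v ∧
      Tendsto (fun n : ℕ => (M.stageMap h g y)^[n] (fun _ => y)) atTop (𝓝 v) then
    hv.choose
  else fun _ => y

/-- One step `Φ_{h,g}(y) = y + h ∑ i, b i • g (v i)` of the Runge–Kutta method. -/
noncomputable def step (M : RungeKutta s) : OneStepMethod E :=
  fun h g y => y + h • ∑ i, M.b i • g (M.stages h g y i)

/-- Consistency of a Runge–Kutta method. -/
def IsConsistent (M : RungeKutta s) : Prop := ∑ i, M.b i = 1

end RungeKutta

/-- The pointwise errors `‖(Φ_{h,fθ})^S(y) - φ_{Sh,f}(y)‖` of the `S`-fold composition,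
for `y` in the ball `B(x, r)`. -/
noncomputable def solverErrors {E : Type*} [NormedAddCommGroup E] [NormedSpace ℝ E]
    (Φ : OneStepMethod E) (f fθ : E → E) (S : ℕ) (h : ℝ) (x : E) (r : ℝ) : Set ℝ :=
  (fun y => ‖(Φ h fθ)^[S] y - flow f (S * h) y‖) '' Metric.ball x r

/-- The learning loss `𝓛 = ‖(Φ_{h,fθ})^S - φ_{Sh,f}‖_{B(x,r)} / (S h)`. -/
noncomputable def learningLoss {E : Type*} [NormedAddCommGroup E] [NormedSpace ℝ E]
    (Φ : OneStepMethod E) (f fθ : E → E) (S : ℕ) (h : ℝ) (x : E) (r : ℝ) : ℝ :=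
  sSup (solverErrors Φ f fθ S h x r) / (S * h)

/-- A real vector viewed as a complex vector. -/
def complexPoint {D : ℕ} (x : Fin D → ℝ) : Fin D → ℂ := fun i => (x i : ℂ)

/-!
The three parts rest on three different ideas.

*The inverse modified equation.* A one-step integrator applied to a field that depends smoothly on
finitely many parameters is jointly smooth, so Taylor coefficients in the step size are smooth
functions of the point. They are handled through iterated divided differences at `0` (`iterSlope`),
whose joint smoothness is the Hadamard lemma `contDiffAt_dslope_fst`. The basic computation is
`step_add_isBigO`: adding `h ^ K • w` to the field changes one step by `h ^ (K + 1) • w(y)` up to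
`O(h ^ (K + 2))`. It lets the coefficients of the inverse modified equation be chosen one by one
(`isIMDE_imdeCoeff`), and it determines them (`IsIMDE.add_localError_isBigO`). As an integrator is
not assumed to be local, uniqueness on `U` also needs `step_sub_step_isBigO_of_germ_eq`: fields with
the same germ at `y` have the same expansion at `y`.

*Runge–Kutta methods are integrators.* For small steps the stage equations have exactly one solution
in a small ball, the limit of the fixed-point iteration. It is therefore the implicit function of
the stage equations, hence smooth (`RungeKutta.contDiffAt_stages`).

*The error bound.* Write `e = fθ - f`. Comparing `S` steps for `fθ` with `S` steps for `f` gives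
`S h e(y)` up to a relative error `q = O(h m / η)` of the supremum of `e` on the ball of radius `η`
around `y`, by Cauchy's estimates (`RungeKutta.norm_sub_le_of_iterate_step`). So
`‖e(y)‖ ≤ A + q sup ‖e‖`, where `A` is the loss plus the global error of the method for `f`. With
`η = r₁ / p` the inequality can be used `p` times in a row, which yields
`‖e(x)‖ ≤ A / (1 - q) + q ^ p (2 m)`; if `q ≤ 1 / e` the first factor is at most `e / (e - 1)`, and
`q ^ p = O(h ^ p)`. The global error is `O(m h ^ p)` with a constant that does not depend on the
field: the numerical step extends holomorphically to complex `h` and is bounded there, so Schwarz's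
lemma controls the remainder of its expansion, Cauchy's estimates for iterated Lie derivatives control the
remainder of the flow, and the two expansions agree up to degree `p` by assumption
(`RungeKutta.norm_step_sub_flow_le`). No constant depends on the dimension: Cauchy's estimates are
used along complex lines, hence hold in every complex Banach space with the same constants.
-/

/-! ### Divided differences of smooth functions with parameters -/

open MeasureTheory in
/-- The divided difference of a globally defined function, as an average of its derivative. -/
theorem dslope_eq_integral {P F : Type*} [NormedAddCommGroup P] [NormedSpace ℝ P]
    [NormedAddCommGroup F] [NormedSpace ℝ F] [CompleteSpace F] {Ψ : ℝ × P → F}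
    (hΨ : ContDiff ℝ 1 Ψ) (z : ℝ × P) :
    dslope (fun t => Ψ (t, z.2)) 0 z.1 =
      ∫ s in (0 : ℝ)..1, fderiv ℝ Ψ (s * z.1, z.2) (1, 0) := by
  obtain ⟨t, p⟩ := z
  have hd : ∀ t : ℝ, HasDerivAt (fun t => Ψ (t, p)) (fderiv ℝ Ψ (t, p) (1, 0)) t := fun t =>
    ((hΨ.differentiable one_ne_zero).differentiableAt.hasFDerivAt (x := (t, p))).comp_hasDerivAt t
      ((hasDerivAt_id t).prodMk (hasDerivAt_const t p))
  have hc : Continuous fun s : ℝ => fderiv ℝ Ψ (s * t, p) (1, 0) := by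
    have := hΨ.continuous_fderiv one_ne_zero
    fun_prop
  by_cases ht : t = 0
  · subst ht
    simp [(hd 0).deriv]
  · have hI : ∫ s in (0 : ℝ)..1, t • fderiv ℝ Ψ (s * t, p) (1, 0) = Ψ (t, p) - Ψ (0, p) := by
      rw [intervalIntegral.integral_eq_sub_of_hasDerivAt (f := fun s => Ψ (s * t, p))]
      · simp
      · intro s _
        exact (hd (s * t)).scomp s (by simpa using (hasDerivAt_id s).mul_const t)
      · exact (hc.const_smul t).intervalIntegrable _ _
    rw [intervalIntegral.integral_smul] at hI
    simp [dslope_of_ne _ ht, slope_def_module, ← hI, smul_smul, inv_mul_cancel₀ ht]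

open MeasureTheory in
/-- An integral over `[0, 1]` of a smooth function with parameters is smooth: it is the convolution
of the indicator function of `[0, 1]` with the integrand, cut off outside `[-1, 1]`. -/
theorem contDiff_integral_zero_one {Z F : Type*} [NormedAddCommGroup Z] [NormedSpace ℝ Z]
    [NormedAddCommGroup F] [NormedSpace ℝ F] [CompleteSpace F] {n : ℕ∞} {u : ℝ × Z → F}
    (hu : ContDiff ℝ n u) : ContDiff ℝ n (fun z => ∫ s in (0 : ℝ)..1, u (s, z)) := by
  let b : ContDiffBump (0 : ℝ) := ⟨1, 2, one_pos, one_lt_two⟩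
  let g : Z → ℝ → F := fun z s => b s • u (-s, z)
  let χ : ℝ → ℝ := (Ioc (0 : ℝ) 1).indicator fun _ => 1
  have hg : ContDiffOn ℝ n (fun q : Z × ℝ => g q.1 q.2) (univ ×ˢ univ) := by
    refine ContDiff.contDiffOn ?_
    refine (b.contDiff.comp contDiff_snd).smul (hu.comp ?_)
    fun_prop
  have key := contDiffOn_convolution_right_with_param_comp (μ := volume)
    (ContinuousLinearMap.lsmul ℝ ℝ : ℝ →L[ℝ] F →L[ℝ] F) (s := (univ : Set Z))
    (v := fun _ => (0 : ℝ)) (f := χ) (g := g) (k := Metric.closedBall 0 2)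
    contDiffOn_const isOpen_univ
    (isCompact_closedBall 0 2) (fun z s _ hs => by
      have : b s = 0 := b.zero_of_le_dist (by
        simp only [Metric.mem_closedBall, not_le] at hs; exact hs.le)
      simp [g, this])
    ((locallyIntegrable_const (1 : ℝ)).indicator measurableSet_Ioc) hg
  rw [contDiffOn_univ] at key
  convert! key using 1
  funext z
  rw [convolution_def, intervalIntegral.integral_of_le zero_le_one,
    ← integral_indicator measurableSet_Ioc]
  refine integral_congr_ae (Eventually.of_forall fun s => ?_)
  by_cases hs : s ∈ Ioc (0 : ℝ) 1
  · have hb : b (-s) = 1 := b.one_of_mem_closedBall (by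
      simp only [Metric.mem_closedBall, dist_zero_right, norm_neg, Real.norm_eq_abs, b]
      rw [abs_of_pos hs.1]; exact hs.2)
    simp [χ, g, hs, hb]
  · simp [χ, hs]

/-- Smooth Hadamard lemma: the divided difference in the first variable, at base point `0`, of a
smooth function is smooth. -/
theorem contDiffAt_dslope_fst {P F : Type*} [NormedAddCommGroup P] [NormedSpace ℝ P]
    [FiniteDimensional ℝ P] [NormedAddCommGroup F] [NormedSpace ℝ F] [CompleteSpace F]
    {Ψ : ℝ × P → F} {p₀ : P} (hΨ : ContDiffAt ℝ ∞ Ψ (0, p₀)) :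
    ContDiffAt ℝ ∞ (fun z : ℝ × P => dslope (fun t => Ψ (t, z.2)) 0 z.1) (0, p₀) := by
  rw [contDiffAt_infty]
  intro n
  have h1 : ContDiffAt ℝ (n + 1 : ℕ) Ψ (0, p₀) := contDiffAt_infty.1 hΨ (n + 1)
  obtain ⟨v, hv, hΨv⟩ := h1.contDiffOn le_rfl (by simp)
  obtain ⟨r, hr, hrv⟩ := Metric.mem_nhds_iff.1 hv
  let b : ContDiffBump ((0, p₀) : ℝ × P) := ⟨r / 3, r / 2, by positivity, by linarith⟩
  -- A globally smooth function that agrees with `Ψ` near the base point.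
  let Θ : ℝ × P → F := fun z => b z • Ψ z
  have hΘ : ContDiff ℝ (n + 1 : ℕ) Θ := by
    rw [contDiff_iff_contDiffAt]
    intro z
    by_cases hz : z ∈ Metric.ball ((0, p₀) : ℝ × P) r
    · exact b.contDiffAt.smul ((hΨv.mono hrv).contDiffAt (Metric.isOpen_ball.mem_nhds hz))
    · have h0 : z ∉ tsupport b := by
        rw [b.tsupport_eq]
        simp only [Metric.mem_closedBall, Metric.mem_ball, not_lt, not_le] at hz ⊢
        exact lt_of_lt_of_le (show r / 2 < r by linarith) hz
      have : Θ =ᶠ[𝓝 z] fun _ => 0 := by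
        filter_upwards [notMem_tsupport_iff_eventuallyEq.1 h0] with w hw
        simp [Θ, hw]
      exact contDiffAt_const.congr_of_eventuallyEq this
  have hΘn : ContDiff ℝ (n : ℕ∞) fun z : ℝ × P => dslope (fun t => Θ (t, z.2)) 0 z.1 := by
    have hu : ContDiff ℝ (n : ℕ∞) fun q : ℝ × (ℝ × P) =>
        fderiv ℝ Θ (q.1 * q.2.1, q.2.2) (1, 0) := by
      have hf : ContDiff ℝ (n : ℕ∞) (fderiv ℝ Θ) := hΘ.fderiv_right (by norm_cast)
      exact (hf.comp ((contDiff_fst.mul (contDiff_fst.comp contDiff_snd)).prodMk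
        (contDiff_snd.comp contDiff_snd))).clm_apply contDiff_const
    convert! contDiff_integral_zero_one hu using 1
    funext z
    exact dslope_eq_integral (hΘ.of_le (by norm_cast; omega)) z
  refine hΘn.contDiffAt.congr_of_eventuallyEq ?_
  have hΘΨ : ∀ t : ℝ, ∀ p : P, |t| < r / 3 → dist p p₀ < r / 3 → Θ (t, p) = Ψ (t, p) := by
    intro t p ht hp
    have : b (t, p) = 1 := b.one_of_mem_closedBall (by
      simp only [Metric.mem_closedBall, Prod.dist_eq, dist_zero_right, Real.norm_eq_abs, b]
      exact max_le ht.le hp.le)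
    simp [Θ, this]
  filter_upwards [Metric.ball_mem_nhds ((0, p₀) : ℝ × P) (show 0 < r / 3 by positivity)] with z hz
  obtain ⟨t, p⟩ := z
  simp only [Metric.mem_ball, Prod.dist_eq, dist_zero_right, Real.norm_eq_abs, sup_lt_iff] at hz
  have h0 := hΘΨ 0 p (by simpa using hr) hz.2
  by_cases ht : t = 0
  · subst ht
    simp only [dslope_same]
    refine Filter.EventuallyEq.deriv_eq ?_
    filter_upwards [Metric.ball_mem_nhds (0 : ℝ) (show 0 < r / 3 by positivity)] with s hs
    exact (hΘΨ s p (by simpa using hs) hz.2).symm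
  · simp only [dslope_of_ne _ ht, slope_def_module]
    rw [h0, hΘΨ t p hz.1 hz.2]

/-! ### Expansions in the step size and the flow -/

/-- The coefficient functions of a polynomial that is `O(h ^ n)` vanish below degree `n`. -/
theorem coeff_eq_zero_of_isBigO {F : Type*} [NormedAddCommGroup F] [NormedSpace ℝ F] {n : ℕ} :
    ∀ {c : ℕ → F}, (fun h : ℝ => ∑ k ∈ Finset.range n, h ^ k • c k)
      =O[𝓝[>] (0 : ℝ)] (fun h : ℝ => h ^ n) → ∀ k < n, c k = 0 := by
  induction n with
  | zero => intro c _ k hk; omega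
  | succ n ih =>
    intro c hc
    have hcont : Tendsto (fun h : ℝ => ∑ k ∈ Finset.range (n + 1), h ^ k • c k) (𝓝[>] (0 : ℝ))
        (𝓝 (c 0)) := by
      have : Continuous fun h : ℝ => ∑ k ∈ Finset.range (n + 1), h ^ k • c k := by fun_prop
      have h2 := this.tendsto 0
      simp only [Finset.sum_range_succ', pow_succ, mul_zero, zero_smul, Finset.sum_const_zero,
        pow_zero, one_smul, zero_add] at h2 ⊢
      exact h2.mono_left nhdsWithin_le_nhds
    have hpow : Tendsto (fun h : ℝ => h ^ (n + 1)) (𝓝[>] (0 : ℝ)) (𝓝 0) := by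
      have := (continuous_pow (M := ℝ) (n + 1)).tendsto 0
      simp only [ne_eq, Nat.add_eq_zero_iff, one_ne_zero, and_false, not_false_eq_true,
        zero_pow] at this
      exact this.mono_left nhdsWithin_le_nhds
    have h0 : c 0 = 0 := tendsto_nhds_unique hcont (hc.trans_tendsto hpow)
    have hc' : (fun h : ℝ => ∑ k ∈ Finset.range n, h ^ k • c (k + 1))
        =O[𝓝[>] (0 : ℝ)] (fun h : ℝ => h ^ n) := by
      have h3 := (isBigO_refl (fun h : ℝ => h⁻¹) (𝓝[>] (0 : ℝ))).smul hc
      refine (h3.congr' ?_ ?_)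
      · filter_upwards [self_mem_nhdsWithin] with h hh
        have hne : h ≠ 0 := ne_of_gt hh
        rw [Finset.sum_range_succ', h0, smul_zero, add_zero, Finset.smul_sum]
        refine Finset.sum_congr rfl fun k _ => ?_
        rw [smul_smul, pow_succ']
        congr 1
        field_simp
      · filter_upwards [self_mem_nhdsWithin] with h hh
        have hne : h ≠ 0 := ne_of_gt hh
        simp only [smul_eq_mul, pow_succ']
        field_simp
    intro k hk
    cases k with
    | zero => exact h0
    | succ k => exact ih hc' k (by omega)

theorem eq_zero_of_pow_smul_isBigO {F : Type*} [NormedAddCommGroup F] [NormedSpace ℝ F] {n : ℕ}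
    {c : F} (hc : (fun h : ℝ => h ^ n • c) =O[𝓝[>] (0 : ℝ)] (fun h : ℝ => h ^ (n + 1))) :
    c = 0 := by
  have := coeff_eq_zero_of_isBigO (n := n + 1) (c := fun k => if k = n then c else 0)
    (by simpa [Finset.sum_range_succ, Finset.sum_ite_eq', smul_ite] using hc) n (by omega)
  simpa using this

/-- The iterated Lie derivatives of the identity map along `f`: the `k`-th time derivative of a
solution `γ` of `y' = f(y)` is `lieIter 𝕜 f k ∘ γ`. -/
noncomputable def lieIter (𝕜 : Type*) {E : Type*} [NontriviallyNormedField 𝕜]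
    [NormedAddCommGroup E] [NormedSpace 𝕜 E] (f : E → E) : ℕ → E → E
  | 0 => id
  | k + 1 => fun u => fderiv 𝕜 (lieIter 𝕜 f k) u (f u)

section Curves

variable {E : Type*} [NormedAddCommGroup E] [NormedSpace ℝ E]

theorem contDiffOn_lieIter {U : Set E} (hU : IsOpen U) {f : E → E} (hf : ContDiffOn ℝ ∞ f U)
    (k : ℕ) : ContDiffOn ℝ ∞ (lieIter ℝ f k) U := by
  induction k with
  | zero => exact contDiffOn_id
  | succ k ih => exact (ih.fderiv_of_isOpen hU (by simp)).clm_apply hf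

/-- Taylor's formula for a curve `γ 0` whose successive derivatives are `γ 1, γ 2, …`. -/
theorem norm_sub_taylor_le {T C : ℝ} {n : ℕ} : ∀ {γ : ℕ → ℝ → E},
    (∀ k < n, ∀ t ∈ Icc 0 T, HasDerivWithinAt (γ k) (γ (k + 1) t) (Icc 0 T) t) →
    (∀ t ∈ Icc 0 T, ‖γ n t‖ ≤ C) → ∀ t ∈ Icc 0 T,
    ‖γ 0 t - ∑ k ∈ Finset.range n, t ^ k • ((k.factorial : ℝ)⁻¹ • γ k 0)‖ ≤ C * t ^ n := by
  induction n with
  | zero => intro γ _ hC t ht; simpa using hC t ht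
  | succ n ih =>
    intro γ hγ hC t ht
    have ih' := ih (γ := fun k => γ (k + 1)) (fun k hk => hγ (k + 1) (by omega)) hC
    have hC0 : 0 ≤ C := (norm_nonneg _).trans (hC t ht)
    have hsub : Icc 0 t ⊆ Icc 0 T := Icc_subset_Icc_right ht.2
    have hder : ∀ s ∈ Icc 0 t, HasDerivWithinAt
        (fun t => γ 0 t - ∑ k ∈ Finset.range (n + 1), t ^ k • ((k.factorial : ℝ)⁻¹ • γ k 0))
        (γ 1 s - ∑ k ∈ Finset.range n, s ^ k • ((k.factorial : ℝ)⁻¹ • γ (k + 1) 0))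
        (Icc 0 t) s := by
      intro s hs
      refine ((hγ 0 (by omega) s (hsub hs)).mono hsub).sub ?_
      simp only [Finset.sum_range_succ' _ n, pow_zero]
      suffices hsum : HasDerivWithinAt (fun t : ℝ => ∑ k ∈ Finset.range n,
          t ^ (k + 1) • (((k + 1).factorial : ℝ)⁻¹ • γ (k + 1) 0))
          (∑ k ∈ Finset.range n, s ^ k • ((k.factorial : ℝ)⁻¹ • γ (k + 1) 0)) (Icc 0 t) s from
        hsum.add_const _
      refine HasDerivWithinAt.fun_sum fun k _ => ?_
      have h1 := ((hasDerivAt_pow (k + 1) s).smul_const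
        (((k + 1).factorial : ℝ)⁻¹ • γ (k + 1) 0)).hasDerivWithinAt (s := Icc 0 t)
      refine h1.congr_deriv ?_
      rw [smul_smul, smul_smul, Nat.factorial_succ]
      congr 1
      push_cast
      have : (k.factorial : ℝ) ≠ 0 := by positivity
      have : (k : ℝ) + 1 ≠ 0 := by positivity
      field_simp
    have hb : ∀ s ∈ Ico 0 t,
        ‖γ 1 s - ∑ k ∈ Finset.range n, s ^ k • ((k.factorial : ℝ)⁻¹ • γ (k + 1) 0)‖
          ≤ C * t ^ n := by
      intro s hs
      refine (ih' s (hsub ⟨hs.1, hs.2.le⟩)).trans ?_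
      have := hs.1
      have := hs.2.le
      gcongr
    have := norm_image_sub_le_of_norm_deriv_le_segment' hder hb t (right_mem_Icc.2 ht.1)
    simp only [Finset.sum_range_succ' _ n] at this ⊢
    simp only [pow_succ, mul_zero, zero_smul, Finset.sum_const_zero, pow_zero, one_smul, zero_add,
      Nat.factorial_zero, Nat.cast_one, inv_one, sub_self, sub_zero] at this ⊢
    linarith

/-- A solution that stays in an open set where `f` is `C¹` is the flow, even if `f` is arbitrary
outside that set: another solution cannot branch off. -/
theorem flow_eq_of_isIntegralCurveOn {V : Set E} (hV : IsOpen V) {f : E → E}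
    (hf : ContDiffOn ℝ 1 f V) {γ : ℝ → E} {t : ℝ} (ht : 0 ≤ t)
    (hγ : IsIntegralCurveOn γ (fun _ => f) (Icc 0 t)) (hγV : ∀ s ∈ Icc 0 t, γ s ∈ V) :
    flow f t (γ 0) = γ t := by
  have hex : ∃ η : ℝ → E, η 0 = γ 0 ∧ IsIntegralCurveOn η (fun _ => f) (Icc 0 t) := ⟨γ, rfl, hγ⟩
  rw [flow, dif_pos hex]
  obtain ⟨hη0, hη⟩ := hex.choose_spec
  set η := hex.choose
  have hηc : ContinuousOn η (Icc 0 t) := fun s hs => (hη s hs).continuousWithinAt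
  have hγc : ContinuousOn γ (Icc 0 t) := fun s hs => (hγ s hs).continuousWithinAt
  have hsub : Icc 0 t ⊆ {s | η s = γ s} := by
    refine IsClosed.Icc_subset_of_forall_exists_gt ?_ hη0 ?_
    · have h := (hηc.prodMk hγc).preimage_isClosed_of_isClosed isClosed_Icc isClosed_diagonal
      convert h using 1
      ext s
      simp [and_comm]
    · rintro s ⟨hs, hs0, hst⟩ b hb
      have hsI : s ∈ Icc 0 t := ⟨hs0, hst.le⟩
      obtain ⟨K, W, hW, hl⟩ := (hf.contDiffAt (hV.mem_nhds (hγV s hsI))).exists_lipschitzOnWith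
      have e1 := (hηc s hsI).preimage_mem_nhdsWithin (by rw [hs]; exact hW)
      have e2 := (hγc s hsI).preimage_mem_nhdsWithin hW
      have hIcc : Icc s t ⊆ Icc 0 t := Icc_subset_Icc_left hs0
      have e3 : η ⁻¹' W ∩ γ ⁻¹' W ∈ 𝓝[≥] s := by
        have := nhdsWithin_mono s hIcc (inter_mem e1 e2)
        rwa [nhdsWithin_Icc_eq_nhdsGE hst] at this
      obtain ⟨c, hc, hcW⟩ := mem_nhdsGE_iff_exists_Icc_subset.1 e3
      set d := min (min b c) t with hd
      have hsd : s < d := lt_min (lt_min hb hc) hst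
      have hdt : d ≤ t := min_le_right _ _
      have hdc : d ≤ c := (min_le_left _ _).trans (min_le_right _ _)
      have hder : ∀ {ζ : ℝ → E}, IsIntegralCurveOn ζ (fun _ => f) (Icc 0 t) →
          ∀ r ∈ Ico s d, HasDerivWithinAt ζ (f (ζ r)) (Ici r) r := by
        intro ζ hζ r hr
        have hr' : r ∈ Icc 0 t := ⟨hs0.trans hr.1, hr.2.le.trans hdt⟩
        refine ((hζ r hr').mono (Icc_subset_Icc_left hr'.1)).mono_of_mem_nhdsWithin ?_
        exact Icc_mem_nhdsGE (hr.2.trans_le hdt)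
      have heq := ODE_solution_unique_of_mem_Icc_right (v := fun _ => f) (s := fun _ => W)
        (K := K) (a := s) (b := d) (fun _ _ => hl)
        (hηc.mono (fun r hr => ⟨hs0.trans hr.1, hr.2.trans hdt⟩)) (hder hη)
        (fun r hr => (hcW ⟨hr.1, hr.2.le.trans hdc⟩).1)
        (hγc.mono (fun r hr => ⟨hs0.trans hr.1, hr.2.trans hdt⟩)) (hder hγ)
        (fun r hr => (hcW ⟨hr.1, hr.2.le.trans hdc⟩).2) hs
      exact ⟨d, heq (right_mem_Icc.2 hsd.le), hsd, (min_le_left _ _).trans (min_le_left _ _)⟩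
  exact hsub (right_mem_Icc.2 ht)

/-- The Picard–Lindelöf theorem, with control of the size of the solution. -/
theorem exists_isIntegralCurveOn [CompleteSpace E] {f : E → E} {y : E} {R m t : ℝ} {K : NNReal}
    (hb : ∀ u ∈ Metric.closedBall y R, ‖f u‖ ≤ m)
    (hl : LipschitzOnWith K f (Metric.closedBall y R)) (hm : 0 ≤ m) (ht : 0 ≤ t)
    (hmt : m * t ≤ R) :
    ∃ γ : ℝ → E, γ 0 = y ∧ IsIntegralCurveOn γ (fun _ => f) (Icc 0 t) ∧
      ∀ s ∈ Icc 0 t, ‖γ s - y‖ ≤ m * s := by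
  have hR : 0 ≤ R := (mul_nonneg hm ht).trans hmt
  lift R to NNReal using hR
  lift m to NNReal using hm
  have hPL : IsPicardLindelof (fun _ => f) (⟨0, left_mem_Icc.2 ht⟩ : Icc 0 t) y R 0 m K :=
    .of_time_independent hb hl (by simpa [ht] using hmt)
  obtain ⟨α, hα⟩ := ODE.FunSpace.exists_isFixedPt_next hPL (Metric.mem_closedBall_self le_rfl)
  have h0 : α.compProj 0 = y := by
    have := α.compProj_val (t := ⟨0, left_mem_Icc.2 ht⟩)
    simp only at this
    rw [this, ← hα, ODE.FunSpace.next_apply₀]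
  have hmem : ∀ s, α.compProj s ∈ Metric.closedBall y R := fun s =>
    α.compProj_mem_closedBall hPL.mul_max_le
  have hder : IsIntegralCurveOn α.compProj (fun _ => f) (Icc 0 t) := by
    intro s hs
    apply ODE.hasDerivWithinAt_picard_Icc (left_mem_Icc.2 ht) hPL.continuousOn_uncurry
      α.continuous_compProj.continuousOn (fun _ _ => hmem _) y hs |>.congr_of_mem _ hs
    intro s' hs'
    nth_rw 1 [← hα]
    rw [ODE.FunSpace.compProj_of_mem hs', ODE.FunSpace.next_apply]
  refine ⟨α.compProj, h0, hder, fun s hs => ?_⟩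
  have := norm_image_sub_le_of_norm_deriv_le_segment' hder (fun r _ => hb _ (hmem r)) s hs
  rwa [h0, sub_zero] at this

/-- Along a solution of `y' = f(y)`, the iterated Lie derivatives differentiate into each other. -/
theorem hasDerivWithinAt_lieIter_comp {f : E → E} {γ : ℝ → E} {t s : ℝ} {k : ℕ}
    (hγ : IsIntegralCurveOn γ (fun _ => f) (Icc 0 t)) (hs : s ∈ Icc 0 t)
    (hd : DifferentiableAt ℝ (lieIter ℝ f k) (γ s)) :
    HasDerivWithinAt (fun r => lieIter ℝ f k (γ r)) (lieIter ℝ f (k + 1) (γ s)) (Icc 0 t) s :=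
  hd.hasFDerivAt.comp_hasDerivWithinAt s (hγ s hs)

/-- The expansion of the flow of a smooth vector field in powers of the time. -/
theorem flow_isBigO [CompleteSpace E] {U : Set E} (hU : IsOpen U) {f : E → E}
    (hf : ContDiffOn ℝ ∞ f U) {y : E} (hy : y ∈ U) (n : ℕ) :
    (fun h : ℝ => flow f h y
        - ∑ k ∈ Finset.range n, h ^ k • ((k.factorial : ℝ)⁻¹ • lieIter ℝ f k y))
      =O[𝓝[>] (0 : ℝ)] (fun h : ℝ => h ^ n) := by
  have hf1 : ContDiffOn ℝ 1 f U := hf.of_le (by simp)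
  obtain ⟨K, W, hW, hl⟩ := (hf1.contDiffAt (hU.mem_nhds hy)).exists_lipschitzOnWith
  have hfc : ContinuousAt f y := (hf1.contDiffAt (hU.mem_nhds hy)).continuousAt
  have hLc : ContinuousAt (lieIter ℝ f n) y :=
    ((contDiffOn_lieIter hU hf n).contDiffAt (hU.mem_nhds hy)).continuousAt
  have hnhds : {u | u ∈ U ∧ u ∈ W ∧ ‖f u‖ < ‖f y‖ + 1 ∧
      ‖lieIter ℝ f n u‖ < ‖lieIter ℝ f n y‖ + 1} ∈ 𝓝 y :=
    inter_mem (hU.mem_nhds hy) (inter_mem hW (inter_mem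
      (hfc.norm.eventually_lt_const (lt_add_one _)) (hLc.norm.eventually_lt_const (lt_add_one _))))
  obtain ⟨R, hR, hball⟩ := Metric.nhds_basis_closedBall.mem_iff.1 hnhds
  set m := ‖f y‖ + 1
  have hm : 0 < m := by positivity
  refine IsBigO.of_bound (‖lieIter ℝ f n y‖ + 1) ?_
  filter_upwards [Ioc_mem_nhdsGT (show 0 < R / m by positivity)] with h hh
  have hmh : m * h ≤ R := by
    have := hh.2
    rw [le_div_iff₀ hm] at this
    linarith
  obtain ⟨γ, rfl, hγ, hγR⟩ := exists_isIntegralCurveOn (f := f) (y := y) (R := R) (m := m) (t := h)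
    (fun u hu => (hball hu).2.2.1.le) (hl.mono fun u hu => (hball hu).2.1) hm.le hh.1.le hmh
  have hmem : ∀ s ∈ Icc 0 h, γ s ∈ Metric.closedBall (γ 0) R := fun s hs => by
    rw [mem_closedBall_iff_norm]
    refine (hγR s hs).trans (le_trans ?_ hmh)
    have := hs.2
    gcongr
  rw [flow_eq_of_isIntegralCurveOn hU hf1 hh.1.le hγ fun s hs => (hball (hmem s hs)).1]
  have := norm_sub_taylor_le (γ := fun k s => lieIter ℝ f k (γ s)) (n := n)
    (C := ‖lieIter ℝ f n (γ 0)‖ + 1)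
    (fun k _ s hs => hasDerivWithinAt_lieIter_comp hγ hs
      (((contDiffOn_lieIter hU hf k).contDiffAt
        (hU.mem_nhds (hball (hmem s hs)).1)).differentiableAt (by simp)))
    (fun s hs => (hball (hmem s hs)).2.2.2.le) h (right_mem_Icc.2 hh.1.le)
  rwa [norm_pow, Real.norm_of_nonneg hh.1.le]

end Curves

/-! ### The inverse modified differential equation -/

/-- The iterated divided differences of `f` at `0`: `iterSlope f n 0` is the `n`-th Taylor
coefficient of `f` at `0`, and `iterSlope f n` is the quotient by `t ^ n` of the `n`-th
remainder. -/
noncomputable def iterSlope {𝕜 F : Type*} [NontriviallyNormedField 𝕜] [NormedAddCommGroup F]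
    [NormedSpace 𝕜 F] (f : 𝕜 → F) : ℕ → 𝕜 → F
  | 0 => f
  | n + 1 => dslope (iterSlope f n) 0

theorem pow_isBigO_pow {m n : ℕ} (hmn : m ≤ n) :
    (fun h : ℝ => h ^ n) =O[𝓝 0] (fun h : ℝ => h ^ m) := by
  refine IsBigO.of_bound 1 ?_
  filter_upwards [Metric.ball_mem_nhds (0 : ℝ) one_pos] with h hh
  rw [one_mul, norm_pow, norm_pow]
  exact pow_le_pow_of_le_one (norm_nonneg _) (le_of_lt (by simpa using hh)) hmn

theorem eq_sum_iterSlope {𝕜 F : Type*} [NontriviallyNormedField 𝕜] [NormedAddCommGroup F]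
    [NormedSpace 𝕜 F] (f : 𝕜 → F) (n : ℕ) (t : 𝕜) :
    f t = ∑ k ∈ Finset.range n, t ^ k • iterSlope f k 0 + t ^ n • iterSlope f n t := by
  induction n with
  | zero => simp [iterSlope]
  | succ n ih =>
    have h := sub_smul_dslope (iterSlope f n) 0 t
    rw [sub_zero] at h
    rw [Finset.sum_range_succ, iterSlope, pow_succ, mul_smul, h, ih]
    module

section Formal

variable {E : Type} [NormedAddCommGroup E] [NormedSpace ℝ E] {Φ : OneStepMethod E}

/-- A one-step integrator applied to a field that depends smoothly on the step size. -/
theorem contDiffAt_step_family (hΦ : IsConsistentIntegrator Φ) {G : ℝ → E → E} {y : E}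
    (hG : ContDiffAt ℝ ∞ (fun z : ℝ × E => G z.1 z.2) (0, y)) :
    ContDiffAt ℝ ∞ (fun z : ℝ × E => Φ z.1 (G z.1) z.2) (0, y) := by
  have h := hΦ.smooth 1 (fun ε => G (ε 0)) 0 y
    (ContDiffAt.comp (f := fun z : (Fin 1 → ℝ) × E => (z.1 0, z.2)) (0, y) hG (by fun_prop))
  exact ContDiffAt.comp (f := fun z : ℝ × E => (z.1, (fun _ : Fin 1 => z.1), z.2)) (0, y) h
    (by fun_prop)

/-- The truncated inverse modified fields, as functions of the step size: the next coefficient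
cancels the leading term of the difference between one step and the flow. -/
noncomputable def imdeTrunc (Φ : OneStepMethod E) (f : E → E) : ℕ → ℝ → E → E
  | 0 => fun _ => f
  | K + 1 => fun h y => imdeTrunc Φ f K h y + h ^ (K + 1) •
      ((((K + 2).factorial : ℝ)⁻¹ • lieIter ℝ f (K + 2) y) -
        iterSlope (fun t => Φ t (imdeTrunc Φ f K t) y) (K + 2) 0)

/-- The coefficients of the inverse modified equation. -/
noncomputable def imdeCoeff (Φ : OneStepMethod E) (f : E → E) : ℕ → E → E
  | 0 => f
  | K + 1 => fun y => (((K + 2).factorial : ℝ)⁻¹ • lieIter ℝ f (K + 2) y) -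
      iterSlope (fun t => Φ t (imdeTrunc Φ f K t) y) (K + 2) 0

theorem truncField_imdeCoeff (Φ : OneStepMethod E) (f : E → E) (K : ℕ) :
    truncField (imdeCoeff Φ f) K = imdeTrunc Φ f K := by
  induction K with
  | zero => ext h y; simp [truncField, imdeCoeff, imdeTrunc]
  | succ K ih =>
    ext h y
    have := congrFun (congrFun ih h) y
    rw [truncField] at this ⊢
    rw [Finset.sum_range_succ, this]
    rfl

theorem contDiffAt_truncField {F : ℕ → E → E} {K : ℕ} {y : E} {h : ℝ}
    (hF : ∀ k ≤ K, ContDiffAt ℝ ∞ (F k) y) :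
    ContDiffAt ℝ ∞ (fun z : ℝ × E => truncField F K z.1 z.2) (h, y) := by
  refine ContDiffAt.sum fun k hk => ?_
  exact (contDiffAt_fst.pow k).smul
    ((hF k (by simpa [Nat.lt_succ_iff] using hk)).comp (h, y) contDiffAt_snd)

theorem contDiffAt_truncField_right {F : ℕ → E → E} {K : ℕ} {y : E} {h : ℝ}
    (hF : ∀ k ≤ K, ContDiffAt ℝ ∞ (F k) y) : ContDiffAt ℝ ∞ (truncField F K h) y :=
  (contDiffAt_truncField hF).comp y (contDiffAt_const.prodMk contDiffAt_id)

variable [FiniteDimensional ℝ E]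

theorem contDiffAt_iterSlope {P : Type*} [NormedAddCommGroup P] [NormedSpace ℝ P]
    [FiniteDimensional ℝ P] {Ψ : ℝ → P → E} {p₀ : P}
    (hΨ : ContDiffAt ℝ ∞ (fun z : ℝ × P => Ψ z.1 z.2) (0, p₀)) (n : ℕ) :
    ContDiffAt ℝ ∞ (fun z : ℝ × P => iterSlope (fun t => Ψ t z.2) n z.1) (0, p₀) := by
  induction n with
  | zero => exact hΨ
  | succ n ih =>
    have := FiniteDimensional.complete ℝ E
    exact contDiffAt_dslope_fst ih

/-- The Taylor expansion of a smooth function of one variable. -/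
theorem sub_taylor_isBigO {u : ℝ → E} (hu : ContDiffAt ℝ ∞ u 0) (n : ℕ) :
    (fun h : ℝ => u h - ∑ k ∈ Finset.range n, h ^ k • iterSlope u k 0)
      =O[𝓝 0] (fun h : ℝ => h ^ n) := by
  have hs : ContDiffAt ℝ ∞ (fun z : ℝ × ℝ => iterSlope u n z.1) (0, (0 : ℝ)) :=
    contDiffAt_iterSlope (Ψ := fun t _ => u t) (p₀ := (0 : ℝ))
      (hu.comp (0, (0 : ℝ)) contDiffAt_fst) n
  have hc : ContinuousAt (iterSlope u n) 0 :=
    ContinuousAt.comp (f := fun t : ℝ => (t, (0 : ℝ))) (x := 0) hs.continuousAt (by fun_prop)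
  have := (isBigO_refl (fun h : ℝ => h ^ n) (𝓝 0)).smul (hc.tendsto.isBigO_one ℝ)
  refine this.congr (fun h => ?_) (fun h => by simp)
  rw [eq_sum_iterSlope u n h, add_sub_cancel_left]

/-- A one-step integrator depends only on the germ of the vector field, up to an error that is
smaller than any power of the step size. Gluing the two fields along the sign of a parameter gives a
family that is smooth near `y` and constant for negative parameters. -/
theorem step_sub_step_isBigO_of_germ_eq (hΦ : IsConsistentIntegrator Φ) {G : ℝ → E → E} {g : E → E}
    {y : E} (hg : ContDiffAt ℝ ∞ g y) (hGg : ∀ᶠ z : ℝ × E in 𝓝 (0, y), G z.1 z.2 = g z.2) (n : ℕ) :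
    (fun h : ℝ => Φ h (G h) y - Φ h g y) =O[𝓝[>] (0 : ℝ)] (fun h : ℝ => h ^ n) := by
  let A : (Fin 1 → ℝ) → E → E := fun ε => if 0 < ε 0 then G (ε 0) else g
  have hA : ContDiffAt ℝ ∞ (fun z : (Fin 1 → ℝ) × E => A z.1 z.2) (0, y) := by
    refine (hg.comp ((0 : Fin 1 → ℝ), y) contDiffAt_snd).congr_of_eventuallyEq ?_
    have hc : Tendsto (fun z : (Fin 1 → ℝ) × E => (z.1 0, z.2)) (𝓝 (0, y)) (𝓝 (0, y)) :=
      Continuous.tendsto' (by fun_prop) _ _ rfl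
    filter_upwards [hc.eventually hGg] with z hz
    simp only [A, Function.comp_apply]
    split_ifs
    · exact hz
    · rfl
  let Ψ : ℝ → ℝ → E := fun ε h => Φ h (A fun _ => ε) y
  have hΨ : ContDiffAt ℝ ∞ (fun z : ℝ × ℝ => Ψ z.1 z.2) (0, 0) :=
    ContDiffAt.comp (f := fun z : ℝ × ℝ => (z.2, (fun _ : Fin 1 => z.1), y)) (0, 0)
      (hΦ.smooth 1 A 0 y hA) (by fun_prop)
  have hneg : ∀ h ε : ℝ, ε ≤ 0 → Ψ ε h = Φ h g y := fun h ε hε => by simp [Ψ, A, not_lt.2 hε]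
  -- A function that is constant on `(-∞, 0]` has vanishing divided differences there.
  have hconst : ∀ u : ℝ → E, ∀ c : E, (∀ ε ≤ 0, u ε = c) → ∀ ε ≤ 0, dslope u 0 ε = 0 := by
    intro u c hu ε hε
    rcases hε.eq_or_lt with rfl | hlt
    · rw [dslope_same]
      by_cases hd : DifferentiableAt ℝ u 0
      · have h1 : HasDerivWithinAt u (deriv u 0) (Iic 0) 0 := hd.hasDerivAt.hasDerivWithinAt
        have h2 : HasDerivWithinAt u 0 (Iic 0) 0 :=
          (hasDerivWithinAt_const (0 : ℝ) (Iic 0) c).congr (fun ε hε => hu ε hε) (hu 0 le_rfl)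
        exact (uniqueDiffWithinAt_Iic (0 : ℝ)).eq_deriv _ h1 h2
      · exact deriv_zero_of_not_differentiableAt hd
    · simp [dslope_of_ne _ hlt.ne, slope_def_module, hu ε hε, hu 0 le_rfl]
  have hvan : ∀ (k : ℕ) (h ε : ℝ), ε ≤ 0 → iterSlope (fun t => Ψ t h) (k + 1) ε = 0 := by
    intro k h
    induction k with
    | zero => exact hconst _ (Φ h g y) (hneg h)
    | succ k ih => exact hconst _ 0 ih
  have hdiff : ∀ h : ℝ, Ψ h h - Φ h g y = h ^ (n + 1) • iterSlope (fun t => Ψ t h) (n + 1) h := by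
    intro h
    have h1 := eq_sum_iterSlope (fun t => Ψ t h) (n + 1) h
    rw [Finset.sum_range_succ', Finset.sum_eq_zero fun k _ => by rw [hvan k h 0 le_rfl, smul_zero],
      zero_add, pow_zero, one_smul, iterSlope, hneg h 0 le_rfl] at h1
    rw [h1, add_sub_cancel_left]
  have hc : ContinuousAt (fun h : ℝ => iterSlope (fun t => Ψ t h) (n + 1) h) 0 :=
    ContinuousAt.comp (f := fun h : ℝ => (h, h)) (x := 0)
      (contDiffAt_iterSlope hΨ (n + 1)).continuousAt (by fun_prop)
  have hO := (isBigO_refl (fun h : ℝ => h ^ (n + 1)) (𝓝 0)).smul (hc.tendsto.isBigO_one ℝ)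
  have hO' := (hO.trans (by simpa using pow_isBigO_pow n.le_succ)).mono
    (nhdsWithin_le_nhds (s := Ioi (0 : ℝ)))
  refine hO'.congr' ?_ EventuallyEq.rfl
  filter_upwards [self_mem_nhdsWithin] with h hh
  rw [← hdiff h]
  simp [Ψ, A, mem_Ioi.1 hh]

/-- Adding `h ^ K • w` to the vector field changes one step by `h ^ (K + 1) • w(y)`, up to higher
order. With the coefficient of `w` as an independent parameter `b`, the change vanishes for `h = 0`
and for `b = 0`, so it is `b h B(h, b)` with a smooth `B`. -/
theorem step_add_isBigO (hΦ : IsConsistentIntegrator Φ) {G : ℝ → E → E} {w : E → E} {y : E}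
    (hG : ContDiffAt ℝ ∞ (fun z : ℝ × E => G z.1 z.2) (0, y))
    (hG' : ∀ a, ContDiffAt ℝ ∞ (G a) y) (hw : ContDiffAt ℝ ∞ w y) {K : ℕ} (hK : 1 ≤ K) :
    (fun h : ℝ => Φ h (fun u => G h u + h ^ K • w u) y - Φ h (G h) y - h ^ (K + 1) • w y)
      =O[𝓝[>] (0 : ℝ)] (fun h : ℝ => h ^ (K + 2)) := by
  have := FiniteDimensional.complete ℝ E
  let A : (Fin 2 → ℝ) → E → E := fun ε u => G (ε 0) u + ε 1 • w u
  have hA : ContDiffAt ℝ ∞ (fun z : (Fin 2 → ℝ) × E => A z.1 z.2) (0, y) := by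
    refine ContDiffAt.add (ContDiffAt.comp (f := fun z : (Fin 2 → ℝ) × E => (z.1 0, z.2)) (0, y) hG
      (by fun_prop)) (ContDiffAt.smul (by fun_prop) (hw.comp ((0 : Fin 2 → ℝ), y) contDiffAt_snd))
  have hA' : ∀ ε, ContDiffAt ℝ ∞ (A ε) y := fun ε => (hG' _).add (contDiffAt_const.smul hw)
  let Ψ : ℝ → ℝ → ℝ → E := fun h a b => Φ h (A ![a, b]) y
  have hvec : ContDiff ℝ ∞ fun z : ℝ × (ℝ × ℝ) => (![z.2.2, z.1] : Fin 2 → ℝ) := by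
    refine contDiff_pi.2 fun i => ?_
    fin_cases i
    · exact contDiff_snd.comp contDiff_snd
    · exact contDiff_fst
  let D₁ : ℝ → ℝ → ℝ → E := fun b h a => dslope (fun b => Ψ h a b) 0 b
  have hD₁ : ContDiffAt ℝ ∞ (fun z : ℝ × (ℝ × ℝ) => D₁ z.1 z.2.1 z.2.2) (0, (0, 0)) := by
    refine contDiffAt_dslope_fst (Ψ := fun z : ℝ × (ℝ × ℝ) => Ψ z.2.1 z.2.2 z.1) ?_
    have h0 : (0 : Fin 2 → ℝ) = ![0, 0] := by ext i; fin_cases i <;> rfl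
    refine ContDiffAt.comp (f := fun z : ℝ × (ℝ × ℝ) => (z.2.1, ![z.2.2, z.1], y)) (0, (0, 0))
      (h0 ▸ hΦ.smooth 2 A 0 y hA) ?_
    exact (contDiffAt_fst.comp _ contDiffAt_snd).prodMk (hvec.contDiffAt.prodMk contDiffAt_const)
  let D₂ : ℝ → ℝ → ℝ → E := fun h b a => dslope (fun h => D₁ b h a) 0 h
  have hD₂ : ContDiffAt ℝ ∞ (fun z : ℝ × (ℝ × ℝ) => D₂ z.1 z.2.1 z.2.2) (0, (0, 0)) := by
    refine contDiffAt_dslope_fst (Ψ := fun z : ℝ × (ℝ × ℝ) => D₁ z.2.1 z.1 z.2.2) ?_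
    exact ContDiffAt.comp (f := fun z : ℝ × (ℝ × ℝ) => (z.2.1, (z.1, z.2.2))) (0, (0, 0)) hD₁
      (by fun_prop)
  have hD₁_eq : ∀ b h a : ℝ, b ≠ 0 → D₁ b h a = b⁻¹ • (Ψ h a b - Ψ h a 0) := by
    intro b h a hb
    simp [D₁, dslope_of_ne _ hb, slope_def_module]
  have hw0 : D₂ 0 0 0 = w y := by
    have hc : ContinuousAt (fun b => D₂ 0 b 0) 0 :=
      ContinuousAt.comp (f := fun b : ℝ => (0, (b, 0))) (x := 0) hD₂.continuousAt (by fun_prop)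
    refine tendsto_nhds_unique
      (hc.tendsto.mono_left (nhdsWithin_le_nhds (s := ({0} : Set ℝ)ᶜ)))
      (tendsto_const_nhds.congr' ?_)
    filter_upwards [self_mem_nhdsWithin] with b hb
    have hb : b ≠ 0 := hb
    have h1 := ((hΦ.consistent _ y (hA' ![0, b])).sub
      (hΦ.consistent _ y (hA' ![0, 0]))).const_smul b⁻¹
    have h2 : (fun h => D₁ b h 0) = fun h => b⁻¹ • (Ψ h 0 b - Ψ h 0 0) :=
      funext fun h => hD₁_eq b h 0 hb
    simp only [D₂, dslope_same, h2]
    refine Eq.trans ?_ (h1.deriv).symm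
    simp [A, smul_smul, inv_mul_cancel₀ hb]
  have hlin : (fun h : ℝ => D₂ h (h ^ K) h - w y) =O[𝓝 0] (fun h : ℝ => h) := by
    have hd : DifferentiableAt ℝ (fun h : ℝ => D₂ h (h ^ K) h) 0 := by
      refine DifferentiableAt.comp (g := fun z : ℝ × (ℝ × ℝ) => D₂ z.1 z.2.1 z.2.2)
        (f := fun h : ℝ => (h, (h ^ K, h))) 0 ?_ (by fun_prop)
      rw [zero_pow (by omega)]
      exact hD₂.differentiableAt (by simp)
    have := hd.isBigO_sub
    simpa [zero_pow (show K ≠ 0 by omega), hw0] using this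
  have hO := ((isBigO_refl (fun h : ℝ => h ^ (K + 1)) (𝓝 0)).smul hlin).mono
    (nhdsWithin_le_nhds (s := Ioi (0 : ℝ)))
  refine hO.congr' ?_ (Eventually.of_forall fun h => by simp [pow_succ])
  filter_upwards [self_mem_nhdsWithin] with h hh
  have hh0 : h ≠ 0 := ne_of_gt hh
  have hb : h ^ K ≠ 0 := pow_ne_zero _ hh0
  have e1 : h • D₂ h (h ^ K) h = D₁ (h ^ K) h h - D₁ (h ^ K) 0 h := by
    have := sub_smul_dslope (fun t => D₁ (h ^ K) t h) 0 h
    rwa [sub_zero] at this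
  have e2 : D₁ (h ^ K) 0 h = 0 := by
    rw [hD₁_eq _ _ _ hb]
    simp only [Ψ]
    rw [hΦ.zero_step _ y (hA' _), hΦ.zero_step _ y (hA' _), sub_self, smul_zero]
  have e3 : Ψ h h (h ^ K) - Ψ h h 0 = h ^ K • (h • D₂ h (h ^ K) h) := by
    rw [e1, e2, sub_zero, hD₁_eq _ _ _ hb, smul_smul, mul_inv_cancel₀ hb, one_smul]
  have e4 : Ψ h h (h ^ K) - Ψ h h 0 = Φ h (fun u => G h u + h ^ K • w u) y - Φ h (G h) y := by
    simp [Ψ, A]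
  rw [← e4, e3, smul_smul, ← pow_succ, smul_sub]

theorem contDiffAt_imdeCoeff (hΦ : IsConsistentIntegrator Φ) {U : Set E} (hU : IsOpen U) {f : E → E}
    (hf : ContDiffOn ℝ ∞ f U) {y : E} (hy : y ∈ U) (k : ℕ) :
    ContDiffAt ℝ ∞ (imdeCoeff Φ f k) y := by
  induction k using Nat.strong_induction_on with
  | _ k ih =>
    cases k with
    | zero => exact hf.contDiffAt (hU.mem_nhds hy)
    | succ K =>
      have hG := contDiffAt_truncField (h := 0) fun k (hk : k ≤ K) => ih k (by omega)
      rw [truncField_imdeCoeff] at hG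
      have h1 := contDiffAt_iterSlope (Ψ := fun t y => Φ t (imdeTrunc Φ f K t) y)
        (contDiffAt_step_family hΦ hG) (K + 2)
      exact (((contDiffOn_lieIter hU hf (K + 2)).contDiffAt (hU.mem_nhds hy)).const_smul _).sub
        (h1.comp y (contDiffAt_const.prodMk contDiffAt_id))

theorem step_isBigO_sq (hΦ : IsConsistentIntegrator Φ) {g : E → E} {y : E}
    (hg : ContDiffAt ℝ ∞ g y) :
    (fun h : ℝ => Φ h g y - (y + h • g y)) =O[𝓝 0] (fun h : ℝ => h ^ 2) := by
  have hu : ContDiffAt ℝ ∞ (fun h : ℝ => Φ h g y) 0 :=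
    (contDiffAt_step_family hΦ (G := fun _ => g) (hg.comp ((0 : ℝ), y) contDiffAt_snd)).comp (0 : ℝ)
      (contDiffAt_id.prodMk contDiffAt_const)
  refine (sub_taylor_isBigO hu 2).congr_left fun h => ?_
  simp [Finset.sum_range_succ, iterSlope, dslope_same, hΦ.zero_step g y hg,
    (hΦ.consistent g y hg).deriv]

theorem flow_isBigO_sq {U : Set E} (hU : IsOpen U) {f : E → E} (hf : ContDiffOn ℝ ∞ f U) {y : E}
    (hy : y ∈ U) :
    (fun h : ℝ => flow f h y - (y + h • f y)) =O[𝓝[>] (0 : ℝ)] (fun h : ℝ => h ^ 2) := by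
  have := FiniteDimensional.complete ℝ E
  refine (flow_isBigO hU hf hy 2).congr_left fun h => ?_
  simp [Finset.sum_range_succ, lieIter]

/-- The inverse modified equation exists. -/
theorem isIMDE_imdeCoeff (hΦ : IsConsistentIntegrator Φ) {U : Set E} (hU : IsOpen U) {f : E → E}
    (hf : ContDiffOn ℝ ∞ f U) : IsIMDE Φ f U (imdeCoeff Φ f) := by
  have := FiniteDimensional.complete ℝ E
  refine ⟨fun k y hy => (contDiffAt_imdeCoeff hΦ hU hf hy k).contDiffWithinAt, fun K y hy => ?_⟩
  have hF := contDiffAt_imdeCoeff hΦ hU hf hy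
  induction K with
  | zero =>
    refine (((step_isBigO_sq hΦ (hf.contDiffAt (hU.mem_nhds hy))).mono nhdsWithin_le_nhds).sub
      (flow_isBigO_sq hU hf hy)).congr_left fun h => ?_
    rw [truncField_imdeCoeff, imdeTrunc]
    abel
  | succ K ih =>
    have hG := contDiffAt_truncField (h := 0) fun k (_ : k ≤ K) => hF k
    have hG' := fun a : ℝ => contDiffAt_truncField_right (h := a) fun k (_ : k ≤ K) => hF k
    simp only [truncField_imdeCoeff] at ih hG hG' ⊢
    have hu : ContDiffAt ℝ ∞ (fun h : ℝ => Φ h (imdeTrunc Φ f K h) y) 0 :=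
      (contDiffAt_step_family hΦ hG).comp (0 : ℝ) (contDiffAt_id.prodMk contDiffAt_const)
    have hpert := step_add_isBigO hΦ hG hG' (hF (K + 1)) (show 1 ≤ K + 1 by omega)
    set c : ℕ → E := fun k => iterSlope (fun h : ℝ => Φ h (imdeTrunc Φ f K h) y) k 0 with hc
    set d : ℕ → E := fun k => (k.factorial : ℝ)⁻¹ • lieIter ℝ f k y with hd
    -- The expansions agree below degree `K + 2`, by the induction hypothesis.
    have hcd : ∀ k < K + 2, c k = d k := by
      intro k hk
      refine sub_eq_zero.1 (coeff_eq_zero_of_isBigO (c := fun k => c k - d k) ?_ k hk)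
      refine (((flow_isBigO hU hf hy (K + 2)).sub
        ((sub_taylor_isBigO hu (K + 2)).mono nhdsWithin_le_nhds)).add ih).congr_left fun h => ?_
      simp only [smul_sub, Finset.sum_sub_distrib, hc, hd]
      abel
    refine ((hpert.add ((sub_taylor_isBigO hu (K + 3)).mono nhdsWithin_le_nhds)).sub
      (flow_isBigO hU hf hy (K + 3))).congr_left fun h => ?_
    have hw : imdeCoeff Φ f (K + 1) y = d (K + 2) - c (K + 2) := rfl
    have hT : (fun u => imdeTrunc Φ f K h u + h ^ (K + 1) • imdeCoeff Φ f (K + 1) u)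
        = imdeTrunc Φ f (K + 1) h := rfl
    have hsum : ∑ k ∈ Finset.range (K + 2), h ^ k • c k = ∑ k ∈ Finset.range (K + 2), h ^ k • d k :=
      Finset.sum_congr rfl fun k hk => by rw [hcd k (Finset.mem_range.1 hk)]
    rw [hT, hw, Finset.sum_range_succ _ (K + 2), Finset.sum_range_succ _ (K + 2), hsum, smul_sub]
    abel

/-- The first coefficient of an inverse modified equation is the vector field itself. -/
theorem IsIMDE.eqOn_zero (hΦ : IsConsistentIntegrator Φ) {U : Set E} (hU : IsOpen U) {f : E → E}
    (hf : ContDiffOn ℝ ∞ f U) {F : ℕ → E → E} (hF : IsIMDE Φ f U F) : EqOn (F 0) f U := by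
  intro y hy
  have h1 := hF.formal_eq 0 y hy
  have h2 := (step_isBigO_sq hΦ ((hF.smooth 0).contDiffAt (hU.mem_nhds hy))).mono
    (nhdsWithin_le_nhds (s := Ioi 0))
  refine sub_eq_zero.1 (eq_zero_of_pow_smul_isBigO (n := 1) ?_)
  refine ((h1.sub h2).add (flow_isBigO_sq hU hf hy)).congr_left fun h => ?_
  have : truncField F 0 h = F 0 := by ext u; simp [truncField]
  rw [this, pow_one, smul_sub]
  abel

/-- If the coefficients between the first one and the `K`-th one vanish, then the `K`-th one and the
local error cancel up to higher order. -/
theorem IsIMDE.add_localError_isBigO (hΦ : IsConsistentIntegrator Φ) {U : Set E} (hU : IsOpen U)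
    {f δ : E → E} {p : ℕ} (hf : ContDiffOn ℝ ∞ f U) (hδ : HasLocalError Φ f U p δ)
    {F : ℕ → E → E} (hF : IsIMDE Φ f U F) {K : ℕ} (hK : K + 1 ≤ p)
    (h0 : ∀ k, 1 ≤ k → k < K + 1 → EqOn (F k) 0 U) {y : E} (hy : y ∈ U) :
    (fun h : ℝ => h ^ (K + 2) • F (K + 1) y + h ^ (p + 1) • δ y)
      =O[𝓝[>] (0 : ℝ)] (fun h : ℝ => h ^ (K + 3)) := by
  have hUy := hU.mem_nhds hy
  have hs : ∀ k, ContDiffAt ℝ ∞ (F k) y := fun k => (hF.smooth k).contDiffAt hUy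
  have h1 := hF.formal_eq (K + 1) y hy
  have h2 := step_add_isBigO hΦ (contDiffAt_truncField (h := 0) fun k (_ : k ≤ K) => hs k)
    (fun a => contDiffAt_truncField_right (h := a) fun k (_ : k ≤ K) => hs k) (hs (K + 1))
    (show 1 ≤ K + 1 by omega)
  have hgerm : ∀ᶠ z : ℝ × E in 𝓝 (0, y), truncField F K z.1 z.2 = f z.2 := by
    filter_upwards [continuousAt_snd.preimage_mem_nhds hUy] with z hz
    rw [truncField, Finset.sum_range_succ', Finset.sum_eq_zero, pow_zero, one_smul, zero_add,
      hF.eqOn_zero hΦ hU hf hz]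
    intro k hk
    rw [h0 (k + 1) (by omega) (by simpa using hk) hz]
    simp
  have h3 := step_sub_step_isBigO_of_germ_eq hΦ (hf.contDiffAt hUy) hgerm (K + 3)
  have h4 := (hδ y hy).trans ((pow_isBigO_pow (show K + 3 ≤ p + 2 by omega)).mono
    nhdsWithin_le_nhds)
  refine (((h1.sub h2).sub h3).sub h4).congr_left fun h => ?_
  have : truncField F (K + 1) h = fun u => truncField F K h u + h ^ (K + 1) • F (K + 1) u := by
    ext u
    rw [truncField, Finset.sum_range_succ]
    rfl
  rw [this]
  abel

theorem IsIMDE.eqOn_zero_of_lt (hΦ : IsConsistentIntegrator Φ) {U : Set E} (hU : IsOpen U)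
    {f δ : E → E} {p : ℕ} (hf : ContDiffOn ℝ ∞ f U) (hδ : HasLocalError Φ f U p δ)
    {F : ℕ → E → E} (hF : IsIMDE Φ f U F) (k : ℕ) (hk : 1 ≤ k) (hkp : k < p) : EqOn (F k) 0 U := by
  induction k using Nat.strong_induction_on with
  | _ k ih =>
    obtain ⟨K, rfl⟩ : ∃ K, k = K + 1 := ⟨k - 1, by omega⟩
    intro y hy
    have h1 := hF.add_localError_isBigO hΦ hU hf hδ hkp.le
      (fun j hj hjK => ih j hjK hj (hjK.trans hkp)) hy
    have h2 : (fun h : ℝ => h ^ (p + 1) • δ y) =O[𝓝[>] (0 : ℝ)] (fun h : ℝ => h ^ (K + 3)) := by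
      have := ((pow_isBigO_pow (show K + 3 ≤ p + 1 by omega)).smul
        (isBigO_refl (fun _ : ℝ => δ y) _)).mono (nhdsWithin_le_nhds (s := Ioi (0 : ℝ)))
      exact this.trans ((isBigO_refl _ _).smul (isBigO_const_const (δ y) one_ne_zero _)
        |>.congr_right fun h => by simp)
    exact eq_zero_of_pow_smul_isBigO (n := K + 2)
      ((h1.sub h2).congr_left fun h => add_sub_cancel_right _ _)

theorem IsIMDE.eqOn_neg_localError (hΦ : IsConsistentIntegrator Φ) {U : Set E} (hU : IsOpen U)
    {f δ : E → E} {p : ℕ} (hp : 1 ≤ p) (hf : ContDiffOn ℝ ∞ f U) (hδ : HasLocalError Φ f U p δ)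
    {F : ℕ → E → E} (hF : IsIMDE Φ f U F) : EqOn (F p) (-δ) U := by
  obtain ⟨K, rfl⟩ : ∃ K, p = K + 1 := ⟨p - 1, by omega⟩
  intro y hy
  have h1 := hF.add_localError_isBigO hΦ hU hf hδ le_rfl (hF.eqOn_zero_of_lt hΦ hU hf hδ) hy
  exact eq_neg_of_add_eq_zero_left (eq_zero_of_pow_smul_isBigO (n := K + 2)
    (h1.congr_left fun h => (smul_add _ _ _).symm))

theorem IsIMDE.truncField_sub_isBigO (hΦ : IsConsistentIntegrator Φ) {U : Set E} (hU : IsOpen U)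
    {f δ : E → E} {p : ℕ} (hf : ContDiffOn ℝ ∞ f U) (hδ : HasLocalError Φ f U p δ)
    {F : ℕ → E → E} (hF : IsIMDE Φ f U F) (K : ℕ) {y : E} (hy : y ∈ U) :
    (fun h : ℝ => truncField F K h y - f y) =O[𝓝[>] (0 : ℝ)] (fun h : ℝ => h ^ p) := by
  have hsum : ∀ h : ℝ, truncField F K h y - f y =
      ∑ k ∈ Finset.range K, h ^ (k + 1) • F (k + 1) y := by
    intro h
    rw [truncField, Finset.sum_range_succ', pow_zero, one_smul, hF.eqOn_zero hΦ hU hf hy,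
      add_sub_cancel_right]
  simp only [hsum]
  refine IsBigO.fun_sum (A := fun k (h : ℝ) => h ^ (k + 1) • F (k + 1) y) fun k _ => ?_
  by_cases hk : k + 1 < p
  · have := hF.eqOn_zero_of_lt hΦ hU hf hδ (k + 1) (by omega) hk hy
    simp only [this, Pi.zero_apply, smul_zero]
    exact isBigO_zero _ _
  · refine ((pow_isBigO_pow (not_lt.1 hk)).mono nhdsWithin_le_nhds).smul
      (isBigO_const_const (F (k + 1) y) (one_ne_zero (α := ℝ)) _) |>.congr_right fun h => by simp

end Formal

/-! ### Stages of a Runge–Kutta method -/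

/-- A map that contracts a closed ball into itself by the factor `1 / 2` has a fixed point there,
and the iteration started at the centre converges to it geometrically. -/
theorem exists_fixedPoint_closedBall {X : Type*} [NormedAddCommGroup X] [CompleteSpace X]
    {T : X → X} {v₀ : X} {R : ℝ} (hR : 0 ≤ R)
    (hmaps : MapsTo T (Metric.closedBall v₀ R) (Metric.closedBall v₀ R))
    (hlip : ∀ u ∈ Metric.closedBall v₀ R, ∀ v ∈ Metric.closedBall v₀ R,
      ‖T u - T v‖ ≤ 1 / 2 * ‖u - v‖) :
    ∃ v ∈ Metric.closedBall v₀ R, T v = v ∧ ∀ n : ℕ, ‖T^[n] v₀ - v‖ ≤ R * (1 / 2) ^ n := by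
  have h0 : v₀ ∈ Metric.closedBall v₀ R := Metric.mem_closedBall_self hR
  have hc : ContractingWith (1 / 2) (hmaps.restrict T _ _) := by
    refine ⟨by rw [← NNReal.coe_lt_coe]; norm_num, LipschitzWith.of_dist_le_mul fun u v => ?_⟩
    have := hlip u u.2 v v.2
    simpa [Subtype.dist_eq, dist_eq_norm] using this
  obtain ⟨v, hv, hfix, -, -⟩ := hc.exists_fixedPoint' Metric.isClosed_closedBall.isComplete hmaps h0
    (edist_ne_top _ _)
  refine ⟨v, hv, hfix, fun n => ?_⟩
  have hmem : ∀ n, T^[n] v₀ ∈ Metric.closedBall v₀ R := fun n => hmaps.iterate n h0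
  induction n with
  | zero => simpa using mem_closedBall_iff_norm'.1 hv
  | succ n ih =>
    rw [Function.iterate_succ_apply']
    nth_rw 1 [← hfix]
    have := hlip _ (hmem n) v hv
    rw [pow_succ]
    linarith

namespace RungeKutta

variable {s : ℕ}

/-- An upper bound for the row sums of the matrix of a Runge–Kutta method. -/
noncomputable def stageBound (M : RungeKutta s) : ℝ := 1 + ∑ i, ∑ j, |M.a i j|

/-- An upper bound for the sum of the absolute values of the weights of a Runge–Kutta method. -/
noncomputable def weightBound (M : RungeKutta s) : ℝ := 1 + ∑ i, |M.b i|

theorem one_le_stageBound (M : RungeKutta s) : 1 ≤ M.stageBound :=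
  le_add_of_nonneg_right (Finset.sum_nonneg fun _ _ => Finset.sum_nonneg fun _ _ => abs_nonneg _)

theorem one_le_weightBound (M : RungeKutta s) : 1 ≤ M.weightBound :=
  le_add_of_nonneg_right (Finset.sum_nonneg fun _ _ => abs_nonneg _)

theorem mem_closedBall_const {X : Type*} [PseudoMetricSpace X] {y : X}
    {R : ℝ} (hR : 0 ≤ R) {v : Fin s → X} :
    v ∈ Metric.closedBall (fun _ : Fin s => y) R ↔ ∀ i, v i ∈ Metric.closedBall y R := by
  simp only [Metric.mem_closedBall, dist_pi_le_iff hR]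

section Bounds

variable {E : Type*} [NormedAddCommGroup E] [NormedSpace ℝ E]

theorem norm_sum_a_smul_le (M : RungeKutta s) {B : ℝ} (hB : 0 ≤ B) {u : Fin s → E}
    (hu : ∀ j, ‖u j‖ ≤ B) (i : Fin s) : ‖∑ j, M.a i j • u j‖ ≤ M.stageBound * B := by
  calc ‖∑ j, M.a i j • u j‖ ≤ ∑ j, |M.a i j| * B := by
        refine norm_sum_le_of_le _ fun j _ => ?_
        rw [norm_smul, Real.norm_eq_abs]
        exact mul_le_mul_of_nonneg_left (hu j) (abs_nonneg _)
    _ = (∑ j, |M.a i j|) * B := by rw [Finset.sum_mul]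
    _ ≤ M.stageBound * B := by
        refine mul_le_mul_of_nonneg_right ?_ hB
        have := Finset.single_le_sum (f := fun i => ∑ j, |M.a i j|)
          (fun i _ => Finset.sum_nonneg fun j _ => abs_nonneg (M.a i j)) (Finset.mem_univ i)
        rw [stageBound]
        linarith

theorem norm_sum_b_smul_le (M : RungeKutta s) {B : ℝ} (hB : 0 ≤ B) {u : Fin s → E}
    (hu : ∀ j, ‖u j‖ ≤ B) : ‖∑ i, M.b i • u i‖ ≤ M.weightBound * B := by
  calc ‖∑ i, M.b i • u i‖ ≤ ∑ i, |M.b i| * B := by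
        refine norm_sum_le_of_le _ fun j _ => ?_
        rw [norm_smul, Real.norm_eq_abs]
        exact mul_le_mul_of_nonneg_left (hu j) (abs_nonneg _)
    _ = (∑ i, |M.b i|) * B := by rw [Finset.sum_mul]
    _ ≤ M.weightBound * B := by
        refine mul_le_mul_of_nonneg_right ?_ hB
        rw [weightBound]
        linarith

/-- The right-hand side of the stage equations, for a step `ζ` in a normed field that may be larger
than `ℝ`. -/
noncomputable def scaledStageMap {𝕜 : Type*} [NormedField 𝕜] [NormedSpace 𝕜 E] (M : RungeKutta s)
    (ζ : 𝕜) (g : E → E) (y : E) (v : Fin s → E) : Fin s → E :=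
  fun i => y + ζ • ∑ j, M.a i j • g (v j)

theorem scaledStageMap_real (M : RungeKutta s) (h : ℝ) (g : E → E) (y : E) :
    M.scaledStageMap h g y = M.stageMap h g y := rfl

/-- Small steps make the stage map a contraction of a ball, with real or complex step size. -/
theorem exists_stages {𝕜 : Type*} [NormedField 𝕜] [NormedSpace 𝕜 E] [CompleteSpace E]
    (M : RungeKutta s) {ζ : 𝕜} {g : E → E} {y : E} {R m ℓ : ℝ} (hR : 0 ≤ R) (hm : 0 ≤ m)
    (hℓ : 0 ≤ ℓ) (hb : ∀ u ∈ Metric.closedBall y R, ‖g u‖ ≤ m)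
    (hl : ∀ u ∈ Metric.closedBall y R, ∀ v ∈ Metric.closedBall y R, ‖g u - g v‖ ≤ ℓ * ‖u - v‖)
    (h1 : ‖ζ‖ * M.stageBound * m ≤ R) (h2 : ‖ζ‖ * M.stageBound * ℓ ≤ 1 / 2) :
    ∃ v : Fin s → E, (∀ i, v i ∈ Metric.closedBall y R) ∧ M.scaledStageMap ζ g y v = v ∧
      ∀ n : ℕ, ‖(M.scaledStageMap ζ g y)^[n] (fun _ => y) - v‖ ≤ R * (1 / 2) ^ n := by
  have hmaps : MapsTo (M.scaledStageMap ζ g y) (Metric.closedBall (fun _ => y) R)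
      (Metric.closedBall (fun _ => y) R) := by
    intro v hv
    rw [mem_closedBall_const hR] at hv ⊢
    intro i
    rw [mem_closedBall_iff_norm, scaledStageMap, add_sub_cancel_left, norm_smul]
    have := M.norm_sum_a_smul_le hm (fun j => hb _ (hv j)) i
    calc _ ≤ ‖ζ‖ * (M.stageBound * m) := by gcongr
      _ ≤ R := by linarith
  have hlip : ∀ u ∈ Metric.closedBall (fun _ => y) R, ∀ v ∈ Metric.closedBall (fun _ => y) R,
      ‖M.scaledStageMap ζ g y u - M.scaledStageMap ζ g y v‖ ≤ 1 / 2 * ‖u - v‖ := by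
    intro u hu v hv
    rw [mem_closedBall_const hR] at hu hv
    refine (pi_norm_le_iff_of_nonneg (by positivity)).2 fun i => ?_
    have hd : ∀ j, ‖g (u j) - g (v j)‖ ≤ ℓ * ‖u - v‖ := fun j =>
      (hl _ (hu j) _ (hv j)).trans (mul_le_mul_of_nonneg_left (norm_le_pi_norm (u - v) j) hℓ)
    have := M.norm_sum_a_smul_le (by positivity) hd i
    simp only [Pi.sub_apply, scaledStageMap, add_sub_add_left_eq_sub, ← smul_sub,
      ← Finset.sum_sub_distrib]
    rw [norm_smul]
    calc _ ≤ ‖ζ‖ * (M.stageBound * (ℓ * ‖u - v‖)) := by gcongr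
      _ = (‖ζ‖ * M.stageBound * ℓ) * ‖u - v‖ := by ring
      _ ≤ 1 / 2 * ‖u - v‖ := by gcongr
  obtain ⟨v, hv, hv'⟩ := exists_fixedPoint_closedBall hR hmaps hlip
  exact ⟨v, (mem_closedBall_const hR).1 hv, hv'⟩

theorem stages_eq_of_tendsto (M : RungeKutta s) {h : ℝ} {g : E → E} {y : E} {v : Fin s → E}
    (hv : M.stageMap h g y v = v)
    (hlim : Tendsto (fun n : ℕ => (M.stageMap h g y)^[n] (fun _ => y)) atTop (𝓝 v)) :
    M.stages h g y = v := by
  have hex : ∃ v : Fin s → E, v = M.stageMap h g y v ∧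
      Tendsto (fun n : ℕ => (M.stageMap h g y)^[n] (fun _ => y)) atTop (𝓝 v) := ⟨v, hv.symm, hlim⟩
  rw [stages, dif_pos hex]
  exact tendsto_nhds_unique hex.choose_spec.2 hlim

theorem tendsto_of_norm_sub_le_half_pow {X : Type*} [NormedAddCommGroup X] {u : ℕ → X} {v : X}
    {R : ℝ} (h : ∀ n, ‖u n - v‖ ≤ R * (1 / 2) ^ n) : Tendsto u atTop (𝓝 v) := by
  refine tendsto_iff_norm_sub_tendsto_zero.2 (squeeze_zero (fun _ => norm_nonneg _) h ?_)
  simpa using (tendsto_pow_atTop_nhds_zero_of_lt_one (r := (1 / 2 : ℝ)) (by norm_num)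
    (by norm_num)).const_mul R

/-- If the field is bounded and Lipschitz on a ball and the step is small, the stages solve the
stage equations and lie in the ball. -/
theorem stages_spec [CompleteSpace E]
    (M : RungeKutta s) {h : ℝ} {g : E → E} {y : E} {R m ℓ : ℝ} (hR : 0 ≤ R) (hm : 0 ≤ m)
    (hℓ : 0 ≤ ℓ) (hb : ∀ u ∈ Metric.closedBall y R, ‖g u‖ ≤ m)
    (hl : ∀ u ∈ Metric.closedBall y R, ∀ v ∈ Metric.closedBall y R, ‖g u - g v‖ ≤ ℓ * ‖u - v‖)
    (h1 : |h| * M.stageBound * m ≤ R) (h2 : |h| * M.stageBound * ℓ ≤ 1 / 2) :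
    M.stageMap h g y (M.stages h g y) = M.stages h g y ∧
      ∀ i, M.stages h g y i ∈ Metric.closedBall y R := by
  obtain ⟨v, hv, hfix, hlim⟩ := M.exists_stages (ζ := h) hR hm hℓ hb hl h1 h2
  rw [scaledStageMap_real] at hfix hlim
  rw [M.stages_eq_of_tendsto hfix (tendsto_of_norm_sub_le_half_pow hlim)]
  exact ⟨hfix, hv⟩

/-- Solutions of the stage equations depend in a Lipschitz way on the initial value and on the
vector field. -/
theorem norm_sub_le_of_stageMap_eq (M : RungeKutta s) {h : ℝ} {f g : E → E} {W : Set E} {y z : E}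
    {v w : Fin s → E} {ℓ m : ℝ} (hv : M.stageMap h g y v = v) (hw : M.stageMap h f z w = w)
    (hvW : ∀ i, v i ∈ W) (hwW : ∀ i, w i ∈ W) (hℓ : 0 ≤ ℓ) (hm : 0 ≤ m)
    (hl : ∀ u ∈ W, ∀ u' ∈ W, ‖f u - f u'‖ ≤ ℓ * ‖u - u'‖) (hgf : ∀ u ∈ W, ‖g u - f u‖ ≤ m)
    (hh : |h| * M.stageBound * ℓ ≤ 1 / 2) (i : Fin s) :
    ‖v i - w i‖ ≤ 2 * (‖y - z‖ + |h| * M.stageBound * m) := by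
  have hd : ∀ j, ‖g (v j) - f (w j)‖ ≤ m + ℓ * ‖v - w‖ := fun j => by
    calc ‖g (v j) - f (w j)‖ ≤ ‖g (v j) - f (v j)‖ + ‖f (v j) - f (w j)‖ :=
          norm_sub_le_norm_sub_add_norm_sub _ _ _
      _ ≤ m + ℓ * ‖v j - w j‖ := add_le_add (hgf _ (hvW j)) (hl _ (hvW j) _ (hwW j))
      _ ≤ m + ℓ * ‖v - w‖ := by
          have := norm_le_pi_norm (v - w) j
          rw [Pi.sub_apply] at this
          gcongr
  have h0 := M.one_le_stageBound
  have key : ‖v - w‖ ≤ ‖y - z‖ + |h| * (M.stageBound * (m + ℓ * ‖v - w‖)) := by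
    refine (pi_norm_le_iff_of_nonneg (by positivity)).2 fun i => ?_
    have h3 := M.norm_sum_a_smul_le (by positivity) hd i
    rw [Pi.sub_apply, ← hv, ← hw]
    have : M.stageMap h g y v i - M.stageMap h f z w i
        = (y - z) + h • ∑ j, M.a i j • (g (v j) - f (w j)) := by
      simp only [stageMap, smul_sub, Finset.sum_sub_distrib]
      abel
    rw [this, hv, hw]
    refine (norm_add_le _ _).trans ?_
    rw [norm_smul, Real.norm_eq_abs]
    gcongr
  have h4 : ‖v i - w i‖ ≤ ‖v - w‖ := norm_le_pi_norm (v - w) i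
  have h5 := mul_le_mul_of_nonneg_right hh (norm_nonneg (v - w))
  nlinarith

theorem stages_zero_step (M : RungeKutta s) (g : E → E) (y : E) : M.stages 0 g y = fun _ => y := by
  have h0 : ∀ v, M.stageMap 0 g y v = fun _ => y := fun v => by ext i; simp [stageMap]
  refine M.stages_eq_of_tendsto (h0 _) (tendsto_const_nhds.congr fun n => ?_)
  cases n with
  | zero => rfl
  | succ n => rw [Function.iterate_succ_apply', h0]

end Bounds

section Smooth

variable {E : Type*} [NormedAddCommGroup E] [NormedSpace ℝ E] [FiniteDimensional ℝ E]

/-- The stages depend smoothly on the step, the parameters and the initial value: for small steps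
they are the implicit function defined by the stage equations. -/
theorem contDiffAt_stages (M : RungeKutta s) {q : ℕ} {g : (Fin q → ℝ) → E → E} {ε₀ : Fin q → ℝ}
    {y₀ : E} (hg : ContDiffAt ℝ ∞ (fun z : (Fin q → ℝ) × E => g z.1 z.2) (ε₀, y₀)) :
    ContDiffAt ℝ ∞ (fun z : ℝ × (Fin q → ℝ) × E => M.stages z.1 (g z.2.1) z.2.2) (0, ε₀, y₀) := by
  have := FiniteDimensional.complete ℝ E
  let H : (ℝ × (Fin q → ℝ) × E) × (Fin s → E) → (Fin s → E) := fun x =>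
    x.2 - M.stageMap x.1.1 (g x.1.2.1) x.1.2.2 x.2
  set z₀ : ℝ × (Fin q → ℝ) × E := (0, ε₀, y₀) with hz₀
  set v₀ : Fin s → E := fun _ => y₀ with hv₀
  have hH : ContDiffAt ℝ ∞ H (z₀, v₀) := by
    refine contDiffAt_snd.sub (contDiffAt_pi.2 fun i => ?_)
    refine ContDiffAt.add (by fun_prop) (ContDiffAt.smul (by fun_prop) ?_)
    refine ContDiffAt.sum fun j _ => contDiffAt_const.smul ?_
    exact ContDiffAt.comp
      (f := fun x : (ℝ × (Fin q → ℝ) × E) × (Fin s → E) => (x.1.2.1, x.2 j)) (z₀, v₀) hg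
      (by fun_prop)
  have hstage : ∀ v, M.stageMap 0 (g ε₀) y₀ v = v₀ := fun v => by ext i; simp [stageMap, hv₀]
  have hH0 : H (z₀, v₀) = 0 := by
    change v₀ - M.stageMap 0 (g ε₀) y₀ v₀ = 0
    rw [hstage, sub_self]
  have hinv : (fderiv ℝ H (z₀, v₀) ∘L .inr ℝ (ℝ × (Fin q → ℝ) × E) (Fin s → E)).IsInvertible := by
    have h1 : HasFDerivAt (fun v => H (z₀, v))
        (fderiv ℝ H (z₀, v₀) ∘L .inr ℝ (ℝ × (Fin q → ℝ) × E) (Fin s → E)) v₀ :=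
      (hH.differentiableAt (by simp)).hasFDerivAt.comp v₀ (hasFDerivAt_prodMk_right z₀ v₀)
    have h2 : HasFDerivAt (fun v => H (z₀, v)) (ContinuousLinearMap.id ℝ (Fin s → E)) v₀ := by
      have : (fun v => H (z₀, v)) = fun v => v - v₀ := funext fun v => by
        change v - M.stageMap 0 (g ε₀) y₀ v = _
        rw [hstage]
      rw [this]
      exact (hasFDerivAt_id v₀).sub_const v₀
    rw [h1.unique h2]
    exact ⟨ContinuousLinearEquiv.refl ℝ _, rfl⟩
  set ψ := hH.implicitFunction (by simp) hinv with hψ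
  have hψs : ContDiffAt ℝ ∞ ψ z₀ := hH.contDiffAt_implicitFunction (by simp) hinv
  have hψ0 : ψ z₀ = v₀ := hH.implicitFunction_apply_self (by simp) hinv
  have hψe : ∀ᶠ z in 𝓝 z₀, H (z, ψ z) = 0 := by
    have := hH.eventually_apply_implicitFunction (by simp) hinv
    simpa only [hH0] using this
  refine hψs.congr_of_eventuallyEq ?_
  -- On a small ball the stages are the only solution of the stage equations.
  obtain ⟨K, W, hW, hKW⟩ := (hg.of_le (show (1 : WithTop ℕ∞) ≤ ∞ by simp)).exists_lipschitzOnWith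
  set m := ‖g ε₀ y₀‖ + 1 with hm
  have hW' : W ∩ {z : (Fin q → ℝ) × E | ‖g z.1 z.2‖ < m} ∈ 𝓝 (ε₀, y₀) :=
    inter_mem hW (hg.continuousAt.norm.eventually_lt_const (lt_add_one _))
  obtain ⟨R, hR, hRW⟩ := Metric.nhds_basis_closedBall.mem_iff.1 hW'
  have hm0 : 0 ≤ m := by positivity
  have hc1 : ContinuousAt (fun z : ℝ × (Fin q → ℝ) × E => |z.1| * M.stageBound * m) z₀ := by
    fun_prop
  have hc2 : ContinuousAt (fun z : ℝ × (Fin q → ℝ) × E => |z.1| * M.stageBound * K) z₀ := by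
    fun_prop
  have hc3 : ContinuousAt (fun z : ℝ × (Fin q → ℝ) × E => dist z.2.1 ε₀) z₀ := by fun_prop
  have hc4 : ContinuousAt (fun z : ℝ × (Fin q → ℝ) × E => dist z.2.2 y₀) z₀ := by fun_prop
  have hc5 : ContinuousAt (fun z : ℝ × (Fin q → ℝ) × E => dist (ψ z) fun _ => z.2.2) z₀ :=
    hψs.continuousAt.dist
      (show ContinuousAt (fun z : ℝ × (Fin q → ℝ) × E => fun _ : Fin s => z.2.2) z₀ by fun_prop)
  filter_upwards [hψe, hc1.eventually_le_const (show _ < R / 2 by simpa [hz₀] using hR),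
    hc2.eventually_le_const (show _ < (1 / 2 : ℝ) by simp [hz₀]),
    hc3.eventually_le_const (show _ < R by simpa [hz₀] using hR),
    hc4.eventually_le_const (show _ < R / 2 by simpa [hz₀] using hR),
    hc5.eventually_le_const (show _ < R / 2 by beta_reduce; rw [hψ0, hv₀, hz₀]; simpa using hR)]
    with z e0 e1 e2 e3 e4 e5
  obtain ⟨h, ε, y⟩ := z
  simp only at e1 e2 e3 e4 e5
  have hball : ∀ u ∈ Metric.closedBall y (R / 2), (ε, u) ∈ Metric.closedBall (ε₀, y₀) R := by
    intro u hu
    rw [Metric.mem_closedBall, Prod.dist_eq]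
    refine max_le e3 ((dist_triangle u y y₀).trans ?_)
    rw [Metric.mem_closedBall] at hu
    linarith
  have hb : ∀ u ∈ Metric.closedBall y (R / 2), ‖g ε u‖ ≤ m := fun u hu => (hRW (hball u hu)).2.le
  have hl : ∀ u ∈ Metric.closedBall y (R / 2), ∀ v ∈ Metric.closedBall y (R / 2),
      ‖g ε u - g ε v‖ ≤ K * ‖u - v‖ := by
    intro u hu v hv
    have := hKW.norm_sub_le (hRW (hball u hu)).1 (hRW (hball v hv)).1
    simpa using this
  obtain ⟨hs1, hs2⟩ := M.stages_spec (by positivity) hm0 K.2 hb hl e1 e2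
  have hψfix : M.stageMap h (g ε) y (ψ (h, ε, y)) = ψ (h, ε, y) := (sub_eq_zero.1 e0).symm
  have hψmem : ∀ i, ψ (h, ε, y) i ∈ Metric.closedBall y (R / 2) :=
    (mem_closedBall_const (by positivity)).1 e5
  ext i
  have := M.norm_sub_le_of_stageMap_eq (m := 0) hs1 hψfix hs2 hψmem K.2 le_rfl hl
    (fun u _ => by simp) e2 i
  simp only [sub_self, norm_zero, mul_zero, add_zero, norm_le_zero_iff] at this
  exact sub_eq_zero.1 this

theorem isConsistentIntegrator_step {M : RungeKutta s} (hM : M.IsConsistent) :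
    IsConsistentIntegrator (M.step : OneStepMethod E) := by
  have hsum : ∀ {q : ℕ} {g : (Fin q → ℝ) → E → E} {ε₀ : Fin q → ℝ} {y₀ : E},
      ContDiffAt ℝ ∞ (fun z : (Fin q → ℝ) × E => g z.1 z.2) (ε₀, y₀) →
      ContDiffAt ℝ ∞ (fun z : ℝ × (Fin q → ℝ) × E =>
        ∑ i, M.b i • g z.2.1 (M.stages z.1 (g z.2.1) z.2.2 i)) (0, ε₀, y₀) := by
    intro q g ε₀ y₀ hg
    refine ContDiffAt.sum fun i _ => contDiffAt_const.smul ?_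
    refine ContDiffAt.comp (g := fun z : (Fin q → ℝ) × E => g z.1 z.2)
      (f := fun z : ℝ × (Fin q → ℝ) × E => (z.2.1, M.stages z.1 (g z.2.1) z.2.2 i))
      (0, ε₀, y₀) ?_ ?_
    · simpa only [stages_zero_step] using hg
    · exact ContDiffAt.prodMk (by fun_prop) (contDiffAt_pi.1 (M.contDiffAt_stages hg) i)
  refine ⟨fun q g ε₀ y₀ hg => ?_, fun g y _ => by simp [step], fun g y hg => ?_⟩
  · exact ContDiffAt.add (by fun_prop) (ContDiffAt.smul (by fun_prop) (hsum hg))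
  · have h1 := hsum (q := 0) (g := fun _ => g) (ε₀ := 0) (y₀ := y)
      (hg.comp ((0 : Fin 0 → ℝ), y) contDiffAt_snd)
    have h2 : ContDiffAt ℝ ∞ (fun h : ℝ => ∑ i, M.b i • g (M.stages h g y i)) 0 :=
      ContDiffAt.comp (f := fun h : ℝ => (h, (0 : Fin 0 → ℝ), y)) 0 h1 (by fun_prop)
    have h3 := ((hasDerivAt_id (0 : ℝ)).smul (h2.differentiableAt (by simp)).hasDerivAt).const_add y
    refine h3.congr_deriv ?_
    rw [IsConsistent] at hM
    simp [stages_zero_step, ← Finset.sum_smul, hM]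

end Smooth

end RungeKutta

/-! ### Estimates for holomorphic vector fields -/

section Holomorphic

variable {E F : Type*} [NormedAddCommGroup E] [NormedSpace ℂ E] [NormedAddCommGroup F]
  [NormedSpace ℂ F]

/-- Cauchy's estimate for the derivative, with constant `2` instead of `1`. -/
theorem norm_fderiv_le_of_bounded_ball {f : E → F} {c : E} {r M : ℝ} (hr : 0 < r)
    (hf : DifferentiableOn ℂ f (Metric.ball c r)) (hb : ∀ u ∈ Metric.ball c r, ‖f u‖ ≤ M) :
    ‖fderiv ℂ f c‖ ≤ 2 * M / r := by
  refine Complex.norm_fderiv_le_div_of_mapsTo_ball hf (fun u hu => ?_) hr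
  rw [mem_closedBall_iff_norm]
  have := norm_sub_le (f u) (f c)
  have h1 := hb u hu
  have h2 := hb c (Metric.mem_ball_self hr)
  linarith

/-- A bounded holomorphic function on a ball is Lipschitz on the ball of half the radius, with a
constant that does not depend on the dimension. -/
theorem norm_sub_le_of_bounded_ball {f : E → F} {c : E} {r M : ℝ} (hr : 0 < r)
    (hf : DifferentiableOn ℂ f (Metric.ball c r)) (hb : ∀ u ∈ Metric.ball c r, ‖f u‖ ≤ M) :
    ∀ u ∈ Metric.ball c (r / 2), ∀ v ∈ Metric.ball c (r / 2),
      ‖f u - f v‖ ≤ 4 * M / r * ‖u - v‖ := by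
  intro u hu v hv
  refine Convex.norm_image_sub_le_of_norm_fderiv_le (𝕜 := ℂ) (fun w hw => ?_) (fun w hw => ?_)
    (convex_ball c (r / 2)) hv hu
  · exact (hf w (Metric.ball_subset_ball (by linarith) hw)).differentiableAt
      (Metric.isOpen_ball.mem_nhds (Metric.ball_subset_ball (by linarith) hw))
  · have hsub : Metric.ball w (r / 2) ⊆ Metric.ball c r :=
      Metric.ball_subset_ball' (by rw [Metric.mem_ball] at hw; linarith)
    refine (norm_fderiv_le_of_bounded_ball (half_pos hr) (hf.mono hsub)
      fun u hu => hb u (hsub hu)).trans_eq ?_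
    field_simp
    ring

theorem norm_dslope_le_of_bounded_ball {g : ℂ → E} {c : E} {r B : ℝ}
    (hg : DifferentiableOn ℂ g (Metric.ball 0 r)) (hb : ∀ ζ ∈ Metric.ball (0 : ℂ) r, ‖g ζ - c‖ ≤ B)
    {ζ : ℂ} (hζ : ζ ∈ Metric.ball (0 : ℂ) r) : ‖dslope g 0 ζ‖ ≤ B * (2 / r) := by
  refine (Complex.norm_dslope_le_div_of_mapsTo_ball (R₂ := 2 * B) hg (fun ξ hξ => ?_) hζ).trans_eq
    (by ring)
  rw [mem_closedBall_iff_norm]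
  have h1 := hb ξ hξ
  have h2 := hb 0 (Metric.mem_ball_self (Metric.pos_of_mem_ball hζ))
  have h3 : g ξ - g 0 = (g ξ - c) - (g 0 - c) := by abel
  rw [h3]
  have := norm_sub_le (g ξ - c) (g 0 - c)
  linarith

/-- Schwarz's lemma for the remainders of the Taylor expansion of a bounded holomorphic function. -/
theorem iterSlope_bound [CompleteSpace E] {g : ℂ → E} {c : E} {r B : ℝ} (hr : 0 < r)
    (hg : DifferentiableOn ℂ g (Metric.ball 0 r)) (hb : ∀ ζ ∈ Metric.ball (0 : ℂ) r, ‖g ζ - c‖ ≤ B)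
    (n : ℕ) : DifferentiableOn ℂ (iterSlope g (n + 1)) (Metric.ball 0 r) ∧
      ∀ ζ ∈ Metric.ball (0 : ℂ) r, ‖iterSlope g (n + 1) ζ‖ ≤ B * (2 / r) ^ (n + 1) := by
  have hn : Metric.ball (0 : ℂ) r ∈ 𝓝 0 := Metric.ball_mem_nhds 0 hr
  induction n with
  | zero =>
    refine ⟨(Complex.differentiableOn_dslope hn).2 hg, fun ζ hζ => ?_⟩
    rw [zero_add, pow_one]
    exact norm_dslope_le_of_bounded_ball hg hb hζ
  | succ n ih =>
    refine ⟨(Complex.differentiableOn_dslope hn).2 ih.1, fun ζ hζ => ?_⟩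
    rw [pow_succ, ← mul_assoc]
    exact norm_dslope_le_of_bounded_ball (c := 0) ih.1 (by simpa using ih.2) hζ

theorem analyticOnNhd_lieIter [CompleteSpace E] {f : E → E} {V : Set E} (hf : AnalyticOnNhd ℂ f V)
    (k : ℕ) : AnalyticOnNhd ℂ (lieIter ℂ f k) V := by
  induction k with
  | zero => exact analyticOnNhd_id
  | succ k ih =>
    intro u hu
    exact AnalyticAt.comp (f := fun v => (fderiv ℂ (lieIter ℂ f k) v, f v))
      ((ContinuousLinearMap.id ℂ (E →L[ℂ] E)).analyticAt_bilinear _)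
      ((ih.fderiv u hu).prod (hf u hu))

/-- Cauchy estimates for the iterated Lie derivatives: each differentiation costs a piece `η` of the
radius. -/
theorem norm_lieIter_le [CompleteSpace E] {f : E → E} {z : E} {ρ m η : ℝ} (hη : 0 < η)
    (hf : AnalyticOnNhd ℂ f (Metric.ball z ρ)) (hb : ∀ u ∈ Metric.ball z ρ, ‖f u‖ ≤ m) (k : ℕ) :
    ∀ u ∈ Metric.ball z (ρ - k * η), ‖lieIter ℂ f (k + 1) u‖ ≤ m * (2 * m / η) ^ k := by
  induction k with
  | zero => intro u hu; simpa [lieIter] using hb u (by simpa using hu)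
  | succ k ih =>
    intro u hu
    rw [Metric.mem_ball] at hu
    push_cast at hu
    have hk : (0 : ℝ) ≤ k * η := by positivity
    have hsub : Metric.ball u η ⊆ Metric.ball z (ρ - k * η) :=
      Metric.ball_subset_ball' (by linarith)
    have hsub' : Metric.ball u η ⊆ Metric.ball z ρ :=
      hsub.trans (Metric.ball_subset_ball (by linarith))
    have h1 := norm_fderiv_le_of_bounded_ball hη
      ((analyticOnNhd_lieIter hf (k + 1)).differentiableOn.mono hsub') fun w hw => ih w (hsub hw)
    have h2 := hb u (hsub' (Metric.mem_ball_self hη))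
    calc ‖lieIter ℂ f (k + 1 + 1) u‖ ≤ ‖fderiv ℂ (lieIter ℂ f (k + 1)) u‖ * ‖f u‖ :=
          ContinuousLinearMap.le_opNorm _ _
      _ ≤ (2 * (m * (2 * m / η) ^ k) / η) * m := by
          have := (norm_nonneg _).trans h1
          gcongr
      _ = m * (2 * m / η) ^ (k + 1) := by rw [pow_succ]; ring

theorem contDiffOn_real_of_analyticOnNhd [CompleteSpace E] {f : E → E} {V : Set E} (hV : IsOpen V)
    (hf : AnalyticOnNhd ℂ f V) : ContDiffOn ℝ 1 f V :=
  (hf.contDiffOn hV.uniqueDiffOn).restrict_scalars ℝ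

/-- The solution of an analytic bounded field, on a time interval that is not too long. -/
theorem exists_isIntegralCurveOn_of_analytic [CompleteSpace E] {f : E → E} {z : E} {ρ m t : ℝ}
    (hρ : 0 < ρ) (hm : 0 < m) (hf : AnalyticOnNhd ℂ f (Metric.ball z ρ))
    (hb : ∀ u ∈ Metric.ball z ρ, ‖f u‖ ≤ m) (ht : 0 ≤ t) (hmt : m * t ≤ ρ / 4) :
    ∃ γ : ℝ → E, γ 0 = z ∧ IsIntegralCurveOn γ (fun _ => f) (Icc 0 t) ∧
      (∀ s ∈ Icc 0 t, ‖γ s - z‖ ≤ m * s) ∧ ∀ s ∈ Icc 0 t, γ s ∈ Metric.closedBall z (ρ / 4) := by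
  have hl := norm_sub_le_of_bounded_ball hρ hf.differentiableOn hb
  have hsub : Metric.closedBall z (ρ / 4) ⊆ Metric.ball z (ρ / 2) :=
    Metric.closedBall_subset_ball (by linarith)
  have hl' : LipschitzOnWith ⟨4 * m / ρ, by positivity⟩ f (Metric.closedBall z (ρ / 4)) :=
    LipschitzOnWith.of_dist_le_mul fun u hu v hv => by
      rw [dist_eq_norm, dist_eq_norm]
      exact hl u (hsub hu) v (hsub hv)
  obtain ⟨γ, h0, hγ, hγm⟩ := exists_isIntegralCurveOn
    (fun u hu => hb u (Metric.closedBall_subset_ball (by linarith) hu)) hl' hm.le ht hmt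
  refine ⟨γ, h0, hγ, hγm, fun s hs => ?_⟩
  rw [mem_closedBall_iff_norm]
  refine (hγm s hs).trans (le_trans ?_ hmt)
  have := hs.2
  gcongr

/-- The expansion of the flow of an analytic field, with a remainder that depends only on the bound
of the field and on the radius. -/
theorem norm_flow_sub_taylor_le [CompleteSpace E] {f : E → E} {z : E} {ρ m h : ℝ} (hρ : 0 < ρ)
    (hm : 0 < m) (hf : AnalyticOnNhd ℂ f (Metric.ball z ρ)) (hb : ∀ u ∈ Metric.ball z ρ, ‖f u‖ ≤ m)
    (hh : 0 ≤ h) (hmh : m * h ≤ ρ / 4) (p : ℕ) :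
    ‖flow f h z - ∑ k ∈ Finset.range (p + 1), h ^ k • ((k.factorial : ℝ)⁻¹ • lieIter ℂ f k z)‖
      ≤ m * (4 * (p + 1) * (m / ρ)) ^ p * h ^ (p + 1) := by
  obtain ⟨γ, rfl, hγ, -, hmem⟩ := exists_isIntegralCurveOn_of_analytic hρ hm hf hb hh hmh
  have hmem' : ∀ s ∈ Icc 0 h, γ s ∈ Metric.ball (γ 0) ρ := fun s hs =>
    Metric.closedBall_subset_ball (by linarith) (hmem s hs)
  rw [flow_eq_of_isIntegralCurveOn Metric.isOpen_ball
    (contDiffOn_real_of_analyticOnNhd Metric.isOpen_ball hf) hh hγ hmem']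
  refine norm_sub_taylor_le (γ := fun k s => lieIter ℂ f k (γ s)) (n := p + 1) (fun k _ s hs => ?_)
    (fun s hs => ?_) h (right_mem_Icc.2 hh)
  · exact ((((analyticOnNhd_lieIter hf k) _ (hmem' s hs)).differentiableAt.hasFDerivAt)
      |>.restrictScalars ℝ).comp_hasDerivWithinAt s (hγ s hs)
  · have hη : 0 < ρ / (2 * (p + 1)) := by positivity
    have := norm_lieIter_le hη hf hb p (γ s) (by
      refine Metric.closedBall_subset_ball ?_ (hmem s hs)
      have : (p : ℝ) * (ρ / (2 * (p + 1))) ≤ ρ / 2 := by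
        rw [mul_div_assoc', div_le_div_iff₀ (by positivity) (by positivity)]
        nlinarith
      linarith)
    refine this.trans_eq ?_
    congr 2
    field_simp
    ring

end Holomorphic

/-! ### The local error for analytic vector fields -/

namespace RungeKutta

variable {s : ℕ} {E : Type*} [NormedAddCommGroup E] [NormedSpace ℂ E] [CompleteSpace E]

/-- The numerical step of an analytic field extends holomorphically to complex step sizes, in a disc
whose radius depends only on the bound of the field and on the radius of the ball. -/
theorem exists_holomorphic_step (M : RungeKutta s) {f : E → E} {z : E} {ρ m R₀ : ℝ} (hρ : 0 < ρ)
    (hm : 0 < m) (hf : DifferentiableOn ℂ f (Metric.ball z ρ))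
    (hb : ∀ u ∈ Metric.ball z ρ, ‖f u‖ ≤ m) (hR₀ : R₀ = ρ / (8 * M.stageBound * m)) :
    ∃ ψ : ℂ → E, DifferentiableOn ℂ ψ (Metric.ball 0 R₀) ∧
      (∀ ζ ∈ Metric.ball (0 : ℂ) R₀, ‖ψ ζ - z‖ ≤ R₀ * (M.weightBound * m)) ∧
      ∀ h : ℝ, (h : ℂ) ∈ Metric.ball (0 : ℂ) R₀ → M.step h f z = ψ h := by
  have hα := M.one_le_stageBound
  have hβ := M.one_le_weightBound
  have hR₀0 : 0 < R₀ := by rw [hR₀]; positivity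
  have hl := norm_sub_le_of_bounded_ball hρ hf hb
  have hsub : Metric.closedBall z (ρ / 8) ⊆ Metric.ball z (ρ / 2) :=
    Metric.closedBall_subset_ball (by linarith)
  have hsub' : Metric.closedBall z (ρ / 4) ⊆ Metric.ball z ρ :=
    Metric.closedBall_subset_ball (by linarith)
  have hstep : ∀ ζ ∈ Metric.ball (0 : ℂ) R₀, ‖ζ‖ * M.stageBound * m ≤ ρ / 8 := by
    intro ζ hζ
    rw [mem_ball_zero_iff, hR₀, lt_div_iff₀ (by positivity)] at hζ
    linarith
  have hex : ∀ ζ ∈ Metric.ball (0 : ℂ) R₀, ∃ v : Fin s → E,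
      (∀ i, v i ∈ Metric.closedBall z (ρ / 8)) ∧ M.scaledStageMap ζ f z v = v ∧
      ∀ n : ℕ, ‖(M.scaledStageMap ζ f z)^[n] (fun _ => z) - v‖ ≤ ρ / 8 * (1 / 2) ^ n := by
    intro ζ hζ
    refine M.exists_stages (m := m) (ℓ := 4 * m / ρ) (by positivity) hm.le (by positivity)
      (fun u hu => hb u (Metric.closedBall_subset_ball (by linarith) hu))
      (fun u hu v hv => hl u (hsub hu) v (hsub hv)) (hstep ζ hζ) ?_
    have := hstep ζ hζ
    rw [mul_div_assoc', div_le_iff₀ hρ]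
    linarith
  choose! v hv hfix hlim using hex
  have hiter : ∀ n, ∀ ζ ∈ Metric.ball (0 : ℂ) R₀, ∀ i,
      (M.scaledStageMap ζ f z)^[n] (fun _ => z) i ∈ Metric.ball z ρ := by
    intro n ζ hζ i
    refine hsub' ?_
    have h1 := (norm_le_pi_norm ((M.scaledStageMap ζ f z)^[n] (fun _ => z) - v ζ) i).trans
      (hlim ζ hζ n)
    have h2 := hv ζ hζ i
    have h3 : ρ / 8 * (1 / 2 : ℝ) ^ n ≤ ρ / 8 * 1 := by
      gcongr
      exact pow_le_one₀ (by norm_num) (by norm_num)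
    rw [mem_closedBall_iff_norm] at h2 ⊢
    rw [Pi.sub_apply] at h1
    have h4 := norm_sub_le_norm_sub_add_norm_sub
      ((M.scaledStageMap ζ f z)^[n] (fun _ => z) i) (v ζ i) z
    linarith
  have hdiff : ∀ n, DifferentiableOn ℂ (fun ζ : ℂ => (M.scaledStageMap ζ f z)^[n] (fun _ => z))
      (Metric.ball (0 : ℂ) R₀) := by
    intro n
    induction n with
    | zero => exact differentiableOn_const _
    | succ n ih =>
      simp only [Function.iterate_succ_apply']
      refine differentiableOn_pi.2 fun i => ?_
      refine (differentiableOn_const z).add (differentiableOn_id.smul ?_)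
      refine DifferentiableOn.fun_sum fun j _ => DifferentiableOn.const_smul ?_ _
      exact hf.comp (differentiableOn_pi.1 ih j) fun ζ hζ => hiter n ζ hζ j
  have hunif : TendstoUniformlyOn (fun n (ζ : ℂ) => (M.scaledStageMap ζ f z)^[n] (fun _ => z)) v
      atTop (Metric.ball (0 : ℂ) R₀) := by
    refine Metric.tendstoUniformlyOn_iff.2 fun ε hε => ?_
    have h0 : Tendsto (fun n : ℕ => ρ / 8 * (1 / 2 : ℝ) ^ n) atTop (𝓝 0) := by
      simpa using (tendsto_pow_atTop_nhds_zero_of_lt_one (r := (1 / 2 : ℝ)) (by norm_num)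
        (by norm_num)).const_mul (ρ / 8)
    filter_upwards [h0.eventually_lt_const hε] with n hn ζ hζ
    rw [dist_comm, dist_eq_norm]
    exact (hlim ζ hζ n).trans_lt hn
  have hvd : DifferentiableOn ℂ v (Metric.ball (0 : ℂ) R₀) :=
    hunif.tendstoLocallyUniformlyOn.differentiableOn (Eventually.of_forall hdiff) Metric.isOpen_ball
  have hvρ : ∀ ζ ∈ Metric.ball (0 : ℂ) R₀, ∀ i, v ζ i ∈ Metric.ball z ρ := fun ζ hζ i =>
    Metric.closedBall_subset_ball (by linarith) (hv ζ hζ i)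
  refine ⟨fun ζ : ℂ => z + ζ • ∑ i, M.b i • f (v ζ i), ?_, fun ζ hζ => ?_, fun h hh => ?_⟩
  · refine (differentiableOn_const z).add (differentiableOn_id.smul ?_)
    refine DifferentiableOn.fun_sum fun j _ => DifferentiableOn.const_smul ?_ _
    exact hf.comp (differentiableOn_pi.1 hvd j) fun ζ hζ => hvρ ζ hζ j
  · rw [add_sub_cancel_left, norm_smul]
    have h1 := M.norm_sum_b_smul_le hm.le fun j => hb _ (hvρ ζ hζ j)
    rw [mem_ball_zero_iff] at hζ
    gcongr
  · have hreal : M.scaledStageMap (h : ℂ) f z = M.stageMap h f z := by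
      ext w i
      simp [scaledStageMap, stageMap]
    have h1 := hfix h hh
    have h2 := tendsto_of_norm_sub_le_half_pow (hlim h hh)
    rw [hreal] at h1 h2
    rw [step, M.stages_eq_of_tendsto h1 h2]
    simp

/-- The local error of a method of order `p` for an analytic field, with a constant that depends
only on the method, on the bound of the field and on the radius of the ball. -/
theorem norm_step_sub_flow_le (M : RungeKutta s) {f δ : E → E} {z : E} {ρ m h : ℝ} {p : ℕ}
    {V : Set E} (hρ : 0 < ρ) (hm : 0 < m) (hf : AnalyticOnNhd ℂ f (Metric.ball z ρ))
    (hb : ∀ u ∈ Metric.ball z ρ, ‖f u‖ ≤ m) (hδ : HasLocalError M.step f V p δ) (hz : z ∈ V)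
    (hh : 0 < h) (hmh : 8 * M.stageBound * (h * m) < ρ) :
    ‖M.step h f z - flow f h z‖ ≤ m * ((2 * M.weightBound * (16 * M.stageBound) ^ p
      + (4 * (p + 1)) ^ p) * (m / ρ) ^ p) * h ^ (p + 1) := by
  have hα := M.one_le_stageBound
  have hβ := M.one_le_weightBound
  set R₀ := ρ / (8 * M.stageBound * m) with hR₀
  have hR₀0 : 0 < R₀ := by positivity
  obtain ⟨ψ, hψ, hψb, hψs⟩ := M.exists_holomorphic_step hρ hm hf.differentiableOn hb hR₀
  have hmem : ∀ t : ℝ, 0 < t → 8 * M.stageBound * (t * m) < ρ →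
      (t : ℂ) ∈ Metric.ball (0 : ℂ) R₀ := by
    intro t ht htm
    rw [mem_ball_zero_iff, Complex.norm_real, Real.norm_of_nonneg ht.le, hR₀,
      lt_div_iff₀ (by positivity)]
    linarith
  have hslope := (iterSlope_bound hR₀0 hψ hψb p).2
  set c : ℕ → E := fun k => iterSlope ψ k 0 with hc
  set d : ℕ → E := fun k => (k.factorial : ℝ)⁻¹ • lieIter ℂ f k z with hd
  set C₁ := R₀ * (M.weightBound * m) * (2 / R₀) ^ (p + 1) with hC₁
  set C₂ := m * (4 * (p + 1) * (m / ρ)) ^ p with hC₂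
  have h1 : ∀ t : ℝ, 0 < t → 8 * M.stageBound * (t * m) < ρ →
      ‖M.step t f z - ∑ k ∈ Finset.range (p + 1), t ^ k • c k‖ ≤ C₁ * t ^ (p + 1) := by
    intro t ht htm
    have htR := hmem t ht htm
    rw [hψs t htR, eq_sum_iterSlope ψ (p + 1) (t : ℂ)]
    have : ∑ k ∈ Finset.range (p + 1), (t : ℂ) ^ k • iterSlope ψ k 0
        = ∑ k ∈ Finset.range (p + 1), t ^ k • c k :=
      Finset.sum_congr rfl fun k _ => by rw [← Complex.ofReal_pow, Complex.coe_smul]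
    rw [this, add_sub_cancel_left, norm_smul, norm_pow, Complex.norm_real,
      Real.norm_of_nonneg ht.le, mul_comm]
    exact mul_le_mul_of_nonneg_right (hslope _ htR) (by positivity)
  have h2 : ∀ t : ℝ, 0 < t → 8 * M.stageBound * (t * m) < ρ →
      ‖flow f t z - ∑ k ∈ Finset.range (p + 1), t ^ k • d k‖ ≤ C₂ * t ^ (p + 1) := by
    intro t ht htm
    refine norm_flow_sub_taylor_le hρ hm hf hb ht.le ?_ p
    have : 0 < t * m := by positivity
    nlinarith
  have hsmall : ∀ᶠ t : ℝ in 𝓝[>] 0, 0 < t ∧ 8 * M.stageBound * (t * m) < ρ := by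
    filter_upwards [Ioo_mem_nhdsGT hR₀0] with t ht
    refine ⟨ht.1, ?_⟩
    have := ht.2
    rw [hR₀, lt_div_iff₀ (by positivity)] at this
    linarith
  have hcd : ∀ k < p + 1, c k - d k = 0 := by
    refine coeff_eq_zero_of_isBigO ?_
    have e1 : (fun t : ℝ => M.step t f z - ∑ k ∈ Finset.range (p + 1), t ^ k • c k)
        =O[𝓝[>] (0 : ℝ)] (fun t : ℝ => t ^ (p + 1)) := by
      refine IsBigO.of_bound C₁ ?_
      filter_upwards [hsmall] with t ht
      rw [norm_pow, Real.norm_of_nonneg ht.1.le]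
      exact h1 t ht.1 ht.2
    have e2 : (fun t : ℝ => flow f t z - ∑ k ∈ Finset.range (p + 1), t ^ k • d k)
        =O[𝓝[>] (0 : ℝ)] (fun t : ℝ => t ^ (p + 1)) := by
      refine IsBigO.of_bound C₂ ?_
      filter_upwards [hsmall] with t ht
      rw [norm_pow, Real.norm_of_nonneg ht.1.le]
      exact h2 t ht.1 ht.2
    have e3 := (hδ z hz).trans ((pow_isBigO_pow (show p + 1 ≤ p + 2 by omega)).mono
      nhdsWithin_le_nhds)
    have e4 : (fun t : ℝ => t ^ (p + 1) • δ z) =O[𝓝[>] (0 : ℝ)] (fun t : ℝ => t ^ (p + 1)) :=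
      (isBigO_refl _ _).smul (isBigO_const_const (δ z) (one_ne_zero (α := ℝ)) _)
        |>.congr_right fun t => by simp
    refine (((e3.add e4).sub e1).add e2).congr_left fun t => ?_
    simp only [smul_sub, Finset.sum_sub_distrib]
    abel
  have hsum : ∑ k ∈ Finset.range (p + 1), h ^ k • c k
      = ∑ k ∈ Finset.range (p + 1), h ^ k • d k :=
    Finset.sum_congr rfl fun k hk => by rw [sub_eq_zero.1 (hcd k (Finset.mem_range.1 hk))]
  have e1 := h1 h hh hmh
  have e2 := h2 h hh hmh
  rw [hsum] at e1
  have e3 := norm_sub_le (M.step h f z - ∑ k ∈ Finset.range (p + 1), h ^ k • d k)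
    (flow f h z - ∑ k ∈ Finset.range (p + 1), h ^ k • d k)
  rw [sub_sub_sub_cancel_right] at e3
  refine (e3.trans (add_le_add e1 e2)).trans_eq ?_
  have e4 : C₁ = m * (2 * M.weightBound * (16 * M.stageBound) ^ p * (m / ρ) ^ p) := by
    have : 2 / R₀ = 16 * M.stageBound * (m / ρ) := by
      rw [hR₀]
      field_simp
      ring
    rw [hC₁, pow_succ]
    have h3 : R₀ * (2 / R₀) = 2 := by field_simp
    calc _ = (R₀ * (2 / R₀)) * (M.weightBound * m) * (2 / R₀) ^ p := by ring
      _ = _ := by rw [h3, this, mul_pow]; ring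
  rw [e4, hC₂, mul_pow (4 * ((p : ℝ) + 1))]
  ring

end RungeKutta

/-! ### Iterated steps -/

namespace RungeKutta

variable {s : ℕ} {E : Type*} [NormedAddCommGroup E] [NormedSpace ℂ E] [CompleteSpace E]

/-- For a step that is small relative to the radius of the ball, the stages from a point near the
centre stay in the half ball, where the field is Lipschitz. -/
theorem stages_of_bounded_ball (M : RungeKutta s) {f : E → E} {y c : E} {δ m h : ℝ} (hδ : 0 < δ)
    (hm : 0 < m) (hf : DifferentiableOn ℂ f (Metric.ball y δ))
    (hb : ∀ u ∈ Metric.ball y δ, ‖f u‖ ≤ m) (hh : 0 ≤ h) (hκ : 16 * M.stageBound * (h * m) ≤ δ)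
    (hc : c ∈ Metric.closedBall y (δ / 4)) :
    M.stageMap h f c (M.stages h f c) = M.stages h f c ∧
      (∀ i, M.stages h f c i ∈ Metric.ball y (δ / 2)) ∧
      (∀ i, ‖M.stages h f c i - c‖ ≤ h * M.stageBound * m) ∧
      ‖M.step h f c - c‖ ≤ h * M.weightBound * m := by
  have hα := M.one_le_stageBound
  have hl := norm_sub_le_of_bounded_ball hδ hf hb
  have hsub : Metric.closedBall c (δ / 8) ⊆ Metric.ball y (δ / 2) := fun u hu => by
    rw [Metric.mem_closedBall] at hu hc
    rw [Metric.mem_ball]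
    linarith [dist_triangle u c y]
  have hsub' : Metric.ball y (δ / 2) ⊆ Metric.ball y δ := Metric.ball_subset_ball (by linarith)
  obtain ⟨h1, h2⟩ := M.stages_spec (h := h) (g := f) (y := c) (R := δ / 8) (m := m) (ℓ := 4 * m / δ)
    (by positivity) hm.le (by positivity) (fun u hu => hb u (hsub' (hsub hu)))
    (fun u hu v hv => hl u (hsub hu) v (hsub hv))
    (by rw [abs_of_nonneg hh]; linarith)
    (by rw [abs_of_nonneg hh, mul_div_assoc', div_le_iff₀ hδ]; linarith)
  have h3 : ∀ i, ‖f (M.stages h f c i)‖ ≤ m := fun i => hb _ (hsub' (hsub (h2 i)))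
  refine ⟨h1, fun i => hsub (h2 i), fun i => ?_, ?_⟩
  · rw [← h1]
    simp only [stageMap, add_sub_cancel_left]
    rw [norm_smul, Real.norm_of_nonneg hh, mul_assoc]
    exact mul_le_mul_of_nonneg_left (M.norm_sum_a_smul_le hm.le h3 i) hh
  · rw [step, add_sub_cancel_left, norm_smul, Real.norm_of_nonneg hh, mul_assoc]
    exact mul_le_mul_of_nonneg_left (M.norm_sum_b_smul_le hm.le h3) hh

/-- One smallness condition on the total step implies those needed for the stages and for the
iterates. -/
theorem small_step_bounds {S a b x δ : ℝ} (hS : 1 ≤ S) (ha : 1 ≤ a) (hb : 1 ≤ b) (hx : 0 ≤ x)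
    (h : 16 * (S * (a * b)) * x ≤ δ) : 16 * a * x ≤ δ ∧ 16 * (S * b) * x ≤ δ := by
  have h1 : 1 ≤ S * b := one_le_mul_of_one_le_of_one_le hS hb
  constructor
  · have : a * x ≤ (S * (a * b)) * x := mul_le_mul_of_nonneg_right (by nlinarith) hx
    linarith
  · have : (S * b) * x ≤ (S * (a * b)) * x := mul_le_mul_of_nonneg_right (by nlinarith) hx
    linarith

/-- As long as the total step `S h` is small, the iterates move with at most the speed of the field
times a constant of the method. -/
theorem iterate_step_bound (M : RungeKutta s) {f : E → E} {y : E} {δ m h : ℝ} {S : ℕ} (hδ : 0 < δ)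
    (hm : 0 < m) (hf : DifferentiableOn ℂ f (Metric.ball y δ))
    (hb : ∀ u ∈ Metric.ball y δ, ‖f u‖ ≤ m) (hh : 0 ≤ h) (hS : 1 ≤ S)
    (hκ : 16 * (S * (M.stageBound * M.weightBound)) * (h * m) ≤ δ) (n : ℕ) (hn : n ≤ S) :
    ‖(M.step h f)^[n] y - y‖ ≤ n * (h * M.weightBound * m) ∧
      (M.step h f)^[n] y ∈ Metric.closedBall y (δ / 4) := by
  have hβ := M.one_le_weightBound
  obtain ⟨hκ1, hκ2⟩ := small_step_bounds (by exact_mod_cast hS) M.one_le_stageBound hβ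
    (by positivity) hκ
  have hball : ∀ n : ℕ, n ≤ S → ‖(M.step h f)^[n] y - y‖ ≤ n * (h * M.weightBound * m) →
      (M.step h f)^[n] y ∈ Metric.closedBall y (δ / 4) := by
    intro n hn hle
    rw [mem_closedBall_iff_norm]
    have : (n : ℝ) * (h * M.weightBound * m) ≤ S * (h * M.weightBound * m) := by gcongr
    linarith
  induction n with
  | zero => simpa using by positivity
  | succ n ih =>
    have ih := ih (by omega)
    suffices hle : ‖(M.step h f)^[n + 1] y - y‖ ≤ (n + 1 : ℕ) * (h * M.weightBound * m) from
      ⟨hle, hball _ hn hle⟩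
    have h1 := (M.stages_of_bounded_ball hδ hm hf hb hh hκ1 ih.2).2.2.2
    rw [Function.iterate_succ_apply']
    have h2 := norm_sub_le_norm_sub_add_norm_sub (M.step h f ((M.step h f)^[n] y))
      ((M.step h f)^[n] y) y
    push_cast
    linarith [ih.1]

/-- Reading off the difference of two fields at a point from the difference of the iterates of their
numerical solutions: the error is a small multiple of the largest difference of the fields on a
ball. -/
theorem norm_sub_le_of_iterate_step (M : RungeKutta s) (hM : M.IsConsistent) {f g : E → E} {y : E}
    {δ m h D : ℝ} {S : ℕ} (hδ : 0 < δ) (hm : 0 < m) (hf : DifferentiableOn ℂ f (Metric.ball y δ))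
    (hg : DifferentiableOn ℂ g (Metric.ball y δ)) (hfb : ∀ u ∈ Metric.ball y δ, ‖f u‖ ≤ m)
    (hgb : ∀ u ∈ Metric.ball y δ, ‖g u‖ ≤ m) (hD : ∀ u ∈ Metric.ball y δ, ‖g u - f u‖ ≤ D)
    (hh : 0 < h) (hS : 1 ≤ S)
    (hκ : 16 * (S * (M.stageBound * M.weightBound)) * (h * m) ≤ δ) :
    ‖g y - f y‖ ≤ ‖(M.step h g)^[S] y - (M.step h f)^[S] y‖ / (S * h) +
      48 * (S * (M.stageBound * M.weightBound ^ 2)) * (h * m / δ) * D := by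
  have hα := M.one_le_stageBound
  have hβ := M.one_le_weightBound
  set α := M.stageBound with hαdef
  set β := M.weightBound with hβdef
  have hS1 : (1 : ℝ) ≤ S := by exact_mod_cast hS
  obtain ⟨hκ1, hκ2⟩ := small_step_bounds hS1 hα hβ (by positivity) hκ
  have hD0 : 0 ≤ D := (norm_nonneg _).trans (hD y (Metric.mem_ball_self hδ))
  set κ := h * m / δ with hκdef
  have hκ0 : 0 ≤ κ := by positivity
  have hκ1' : 16 * α * κ ≤ 1 := by rw [hκdef, mul_div_assoc', div_le_one hδ]; exact hκ1
  have hκ2' : 16 * (S * β) * κ ≤ 1 := by rw [hκdef, mul_div_assoc', div_le_one hδ]; exact hκ2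
  have hfl := norm_sub_le_of_bounded_ball hδ hf hfb
  have hel := norm_sub_le_of_bounded_ball hδ (hg.sub hf) hD
  have hsub : Metric.ball y (δ / 2) ⊆ Metric.ball y δ := Metric.ball_subset_ball (by linarith)
  have hy : y ∈ Metric.ball y (δ / 2) := Metric.mem_ball_self (by positivity)
  set q := 48 * (S * (α * β ^ 2)) * κ * D with hq
  have key : ∀ n : ℕ, n ≤ S →
      ‖(M.step h g)^[n] y - (M.step h f)^[n] y‖ ≤ n * (h * (β * (4 * D))) ∧
      ‖(M.step h g)^[n] y - (M.step h f)^[n] y - (n * h) • (g y - f y)‖ ≤ n * (h * q) := by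
    intro n
    induction n with
    | zero => intro _; simp
    | succ n ih =>
      intro hn
      obtain ⟨ih1, ih2⟩ := ih (by omega)
      have hnS : (n : ℝ) ≤ S := by exact_mod_cast (by omega : n ≤ S)
      obtain ⟨hY, hYb⟩ := M.iterate_step_bound hδ hm hg hgb hh.le hS hκ n (by omega)
      obtain ⟨hZ, hZb⟩ := M.iterate_step_bound hδ hm hf hfb hh.le hS hκ n (by omega)
      simp only [Function.iterate_succ_apply']
      set Y := (M.step h g)^[n] y with hYdef
      set Z := (M.step h f)^[n] y with hZdef
      obtain ⟨hv, hvb, hvY, -⟩ := M.stages_of_bounded_ball hδ hm hg hgb hh.le hκ1 hYb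
      obtain ⟨hw, hwb, -, -⟩ := M.stages_of_bounded_ball hδ hm hf hfb hh.le hκ1 hZb
      have hvw := M.norm_sub_le_of_stageMap_eq hv hw hvb hwb (by positivity) hD0 hfl
        (fun u hu => hD u (hsub hu)) (by
          rw [abs_of_pos hh, mul_div_assoc', div_le_iff₀ hδ]
          linarith)
      rw [abs_of_pos hh] at hvw
      set v := M.stages h g Y
      set w := M.stages h f Z
      have hnκ : (n : ℝ) * β * κ ≤ S * β * κ := by gcongr
      -- The change of `f` between the two families of stages.
      have hfvw : ∀ i, ‖f (v i) - f (w i)‖ ≤ 8 * κ * (4 * (n * β) + α) * D := by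
        intro i
        calc ‖f (v i) - f (w i)‖ ≤ 4 * m / δ * ‖v i - w i‖ := hfl _ (hvb i) _ (hwb i)
          _ ≤ 4 * m / δ * (2 * (n * (h * (β * (4 * D))) + h * α * D)) := by
              gcongr
              exact (hvw i).trans (by gcongr)
          _ = 8 * κ * (4 * (n * β) + α) * D := by rw [hκdef]; field_simp; ring
      have hA : ∀ i, ‖g (v i) - f (w i)‖ ≤ 4 * D := by
        intro i
        have h1 := norm_sub_le_norm_sub_add_norm_sub (g (v i)) (f (v i)) (f (w i))
        have h2 := hD _ (hsub (hvb i))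
        have h3 : 8 * κ * (4 * (n * β) + α) * D ≤ 3 * D := by
          gcongr
          linarith
        linarith [hfvw i]
      have hB : ∀ i, ‖(g (v i) - f (w i)) - (g y - f y)‖ ≤ 48 * (S * (α * β)) * κ * D := by
        intro i
        have h1 : ‖(g (v i) - f (v i)) - (g y - f y)‖ ≤ 4 * κ * (α + n * β) * D := by
          calc _ ≤ 4 * D / δ * ‖v i - y‖ := hel _ (hvb i) _ hy
            _ ≤ 4 * D / δ * (h * α * m + n * (h * β * m)) := by
                gcongr
                exact (norm_sub_le_norm_sub_add_norm_sub _ Y _).trans (add_le_add (hvY i) hY)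
            _ = 4 * κ * (α + n * β) * D := by rw [hκdef]; field_simp
        have h2 : (g (v i) - f (w i)) - (g y - f y)
            = ((g (v i) - f (v i)) - (g y - f y)) + (f (v i) - f (w i)) := by abel
        have h3 : α ≤ S * (α * β) := by
          nlinarith [one_le_mul_of_one_le_of_one_le hS1 hβ]
        have h4 : (n : ℝ) * β ≤ S * (α * β) := by
          have : (n : ℝ) * β ≤ S * β := by gcongr
          nlinarith [mul_pos (lt_of_lt_of_le one_pos hS1) (lt_of_lt_of_le one_pos hβ)]
        rw [h2]
        refine (norm_add_le _ _).trans ((add_le_add h1 (hfvw i)).trans ?_)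
        calc _ = (12 * α + 36 * (n * β)) * (κ * D) := by ring
          _ ≤ (12 * (S * (α * β)) + 36 * (S * (α * β))) * (κ * D) := by gcongr
          _ = 48 * (S * (α * β)) * κ * D := by ring
      have hstep : M.step h g Y - M.step h f Z
          = (Y - Z) + h • ∑ i, M.b i • (g (v i) - f (w i)) := by
        simp only [step, smul_sub, Finset.sum_sub_distrib]
        abel
      constructor
      · rw [hstep]
        refine (norm_add_le _ _).trans ?_
        rw [norm_smul, Real.norm_of_nonneg hh.le]
        have := mul_le_mul_of_nonneg_left (M.norm_sum_b_smul_le (by positivity) hA) hh.le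
        push_cast
        linarith
      · have hcons : g y - f y = ∑ i, M.b i • (g y - f y) := by
          rw [← Finset.sum_smul, show ∑ i, M.b i = 1 from hM, one_smul]
        have hdec : M.step h g Y - M.step h f Z - ((n + 1 : ℕ) * h) • (g y - f y)
            = (Y - Z - (n * h) • (g y - f y))
              + h • ∑ i, M.b i • ((g (v i) - f (w i)) - (g y - f y)) := by
          have h5 : h • ∑ i, M.b i • ((g (v i) - f (w i)) - (g y - f y))
              = h • ∑ i, M.b i • (g (v i) - f (w i)) - h • (g y - f y) := by
            rw [← smul_sub]
            congr 1
            conv_rhs => rw [hcons, ← Finset.sum_sub_distrib]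
            simp only [smul_sub]
          rw [hstep, h5]
          push_cast
          rw [add_mul, one_mul, add_smul]
          abel
        rw [hdec]
        refine (norm_add_le _ _).trans ?_
        rw [norm_smul, Real.norm_of_nonneg hh.le]
        have := mul_le_mul_of_nonneg_left (M.norm_sum_b_smul_le (by positivity) hB) hh.le
        have hqe : β * (48 * (S * (α * β)) * κ * D) = q := by rw [hq]; ring
        rw [← hβdef, hqe] at this
        push_cast
        linarith
  have h1 := (key S le_rfl).2
  have hSh : 0 < S * h := by positivity
  have h2 : S * h * ‖g y - f y‖ ≤
      ‖(M.step h g)^[S] y - (M.step h f)^[S] y‖ + S * (h * q) := by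
    have h3 := norm_sub_norm_le ((S * h) • (g y - f y)) ((M.step h g)^[S] y - (M.step h f)^[S] y)
    rw [norm_sub_rev ((S * h) • (g y - f y)), norm_smul, Real.norm_of_nonneg hSh.le] at h3
    linarith
  rw [div_add' _ _ _ hSh.ne', le_div_iff₀ hSh]
  linarith

/-- The global error of a method of order `p` after `S` steps. -/
theorem norm_iterate_step_sub_flow_le (M : RungeKutta s) {f δ : E → E} {y : E} {ρ m h : ℝ} {p S : ℕ}
    {V : Set E} (hρ : 0 < ρ) (hm : 0 < m) (hf : AnalyticOnNhd ℂ f (Metric.ball y ρ))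
    (hb : ∀ u ∈ Metric.ball y ρ, ‖f u‖ ≤ m) (hδ : HasLocalError M.step f V p δ)
    (hV : Metric.ball y ρ ⊆ V) (hh : 0 < h) (hS : 1 ≤ S)
    (hκ : 16 * (S * (M.stageBound * M.weightBound)) * (h * m) < ρ) :
    ‖(M.step h f)^[S] y - flow f (S * h) y‖ ≤ 2 * S * (m * ((2 * M.weightBound *
        (16 * M.stageBound) ^ p + (4 * (p + 1)) ^ p) * (m / (ρ / 2)) ^ p) * h ^ (p + 1)) ∧
      ‖flow f (S * h) y - y‖ ≤ m * (S * h) := by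
  have hα := M.one_le_stageBound
  have hβ := M.one_le_weightBound
  have hS1 : (1 : ℝ) ≤ S := by exact_mod_cast hS
  have hhm : 0 < h * m := by positivity
  obtain ⟨hκ1, hκ2⟩ := small_step_bounds hS1 hα hβ hhm.le hκ.le
  have hSb : (S : ℝ) * (h * m) ≤ S * M.weightBound * (h * m) := by
    gcongr
    nlinarith
  have hκ1s : 16 * M.stageBound * (h * m) < ρ := by
    refine lt_of_le_of_lt ?_ hκ
    gcongr
    nlinarith [one_le_mul_of_one_le_of_one_le hS1 hβ]
  have hSh : 0 ≤ S * h := by positivity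
  obtain ⟨γ, hγ0, hγ, hγm, hγb⟩ := exists_isIntegralCurveOn_of_analytic hρ hm hf hb hSh
    (by linarith)
  have hsub : Metric.closedBall y (ρ / 4) ⊆ Metric.ball y ρ :=
    Metric.closedBall_subset_ball (by linarith)
  have hf1 := contDiffOn_real_of_analyticOnNhd Metric.isOpen_ball hf
  have hflow : flow f (S * h) y = γ (S * h) := by
    rw [← hγ0]
    exact flow_eq_of_isIntegralCurveOn Metric.isOpen_ball hf1 hSh hγ
      fun r hr => hsub (hγb r hr)
  rw [hflow]
  refine ⟨?_, hγm _ (right_mem_Icc.2 hSh)⟩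
  set L := m * ((2 * M.weightBound * (16 * M.stageBound) ^ p + (4 * (p + 1)) ^ p)
    * (m / (ρ / 2)) ^ p) * h ^ (p + 1) with hL
  have hL0 : 0 ≤ L := by positivity
  have key : ∀ n : ℕ, n ≤ S → ‖(M.step h f)^[n] y - γ (n * h)‖ ≤ 2 * n * L := by
    intro n
    induction n with
    | zero => intro _; simp [hγ0]
    | succ n ih =>
      intro hn
      have ih := ih (by omega)
      have hnS : (n : ℝ) + 1 ≤ S := by exact_mod_cast hn
      have hnh : (n : ℝ) * h ∈ Icc 0 (S * h) := ⟨by positivity, by gcongr; linarith⟩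
      have hZb := (M.iterate_step_bound hρ hm hf.differentiableOn hb hh.le hS hκ.le n (by omega)).2
      have hcb := hγb _ hnh
      rw [Function.iterate_succ_apply']
      set Z := (M.step h f)^[n] y
      set c := γ (n * h) with hc
      -- The exact solution over one step, starting at `c`.
      have hshift : flow f h c = γ ((n + 1 : ℕ) * h) := by
        have hmaps : MapsTo (fun r : ℝ => n * h + r) (Icc 0 h) (Icc 0 (S * h)) := fun r hr =>
          ⟨by have := hr.1; positivity, by nlinarith [hr.2]⟩
        have h1 : IsIntegralCurveOn (fun r => γ (n * h + r)) (fun _ => f) (Icc 0 h) := by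
          intro r hr
          have := (hγ _ (hmaps hr)).scomp r
            ((hasDerivWithinAt_id r (Icc 0 h)).const_add (n * h)) hmaps
          simp only [one_smul] at this
          exact this
        have h2 := flow_eq_of_isIntegralCurveOn Metric.isOpen_ball hf1 hh.le h1
          fun r hr => hsub (hγb _ (hmaps hr))
        simp only [add_zero] at h2
        rw [hc, h2]
        push_cast
        ring_nf
      obtain ⟨hv, hvb, -, -⟩ := M.stages_of_bounded_ball hρ hm hf.differentiableOn hb hh.le hκ1 hZb
      obtain ⟨hw, hwb, -, -⟩ := M.stages_of_bounded_ball hρ hm hf.differentiableOn hb hh.le hκ1 hcb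
      have hfl := norm_sub_le_of_bounded_ball hρ hf.differentiableOn hb
      have hvw := M.norm_sub_le_of_stageMap_eq (m := 0) hv hw hvb hwb (by positivity) le_rfl hfl
        (fun u hu => by simp) (by
          rw [abs_of_pos hh, mul_div_assoc', div_le_iff₀ hρ]
          linarith)
      simp only [mul_zero, add_zero] at hvw
      have hstab : ‖M.step h f Z - M.step h f c‖ ≤ ‖Z - c‖ + L := by
        have h1 : M.step h f Z - M.step h f c = (Z - c) +
            h • ∑ i, M.b i • (f (M.stages h f Z i) - f (M.stages h f c i)) := by
          simp only [step, smul_sub, Finset.sum_sub_distrib]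
          abel
        have h2 : ∀ i, ‖f (M.stages h f Z i) - f (M.stages h f c i)‖
            ≤ 4 * m / ρ * (2 * (2 * n * L)) := fun i =>
          (hfl _ (hvb i) _ (hwb i)).trans (by
            gcongr
            exact (hvw i).trans (by gcongr))
        have h3 := mul_le_mul_of_nonneg_left (M.norm_sum_b_smul_le (by positivity) h2) hh.le
        have h4 : h * (M.weightBound * (4 * m / ρ * (2 * (2 * n * L))))
            = 16 * (n * M.weightBound) * (h * m) / ρ * L := by field_simp; ring
        have h5 : 16 * (n * M.weightBound) * (h * m) / ρ * L ≤ 1 * L := by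
          gcongr
          rw [div_le_one hρ]
          refine le_trans ?_ hκ2
          gcongr
          linarith
        rw [h1]
        refine (norm_add_le _ _).trans ?_
        rw [norm_smul, Real.norm_of_nonneg hh.le]
        linarith
      have hsub2 : Metric.ball c (ρ / 2) ⊆ Metric.ball y ρ :=
        Metric.ball_subset_ball' (by rw [Metric.mem_closedBall] at hcb; linarith)
      have hloc := M.norm_step_sub_flow_le (h := h) (half_pos hρ) hm (fun u hu => hf u (hsub2 hu))
        (fun u hu => hb u (hsub2 hu)) hδ (hV (hsub hcb)) hh (by linarith)
      rw [← hL, hshift] at hloc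
      have := norm_sub_le_norm_sub_add_norm_sub (M.step h f Z) (M.step h f c) (γ ((n + 1 : ℕ) * h))
      push_cast at this hloc ⊢
      linarith
  exact key S le_rfl

end RungeKutta

/-! ### The error bound -/

namespace RungeKutta

variable {s : ℕ} {E : Type*} [NormedAddCommGroup E] [NormedSpace ℂ E] [CompleteSpace E]

/-- On the ball `B(x, r₁)` the errors of the iterated method are bounded. -/
theorem bddAbove_solverErrors (M : RungeKutta s) {f fθ : E → E} {x : E} {r₁ r₂ m h : ℝ} {S : ℕ}
    (hr₂ : 0 < r₂) (hm : 0 < m) (hf : AnalyticOnNhd ℂ f (Metric.ball x (r₁ + r₂)))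
    (hfθ : AnalyticOnNhd ℂ fθ (Metric.ball x (r₁ + r₂)))
    (hb : ∀ u ∈ Metric.ball x (r₁ + r₂), ‖f u‖ ≤ m)
    (hbθ : ∀ u ∈ Metric.ball x (r₁ + r₂), ‖fθ u‖ ≤ m) {δ : E → E} {p : ℕ}
    (hδ : HasLocalError M.step f (Metric.ball x (r₁ + r₂)) p δ) (hh : 0 < h) (hS : 1 ≤ S)
    (hκ : 16 * (S * (M.stageBound * M.weightBound)) * (h * m) < r₂) :
    BddAbove (solverErrors M.step f fθ S h x r₁) := by
  refine ⟨S * (h * M.weightBound * m) + m * (S * h), ?_⟩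
  rintro _ ⟨y, hy, rfl⟩
  have hsub : Metric.ball y r₂ ⊆ Metric.ball x (r₁ + r₂) :=
    Metric.ball_subset_ball' (by rw [Metric.mem_ball] at hy; linarith)
  have h1 := (M.iterate_step_bound hr₂ hm (hfθ.differentiableOn.mono hsub)
    (fun u hu => hbθ u (hsub hu)) hh.le hS hκ.le S le_rfl).1
  have h2 := (M.norm_iterate_step_sub_flow_le hr₂ hm (fun u hu => hf u (hsub hu))
    (fun u hu => hb u (hsub hu)) hδ hsub hh hS hκ).2
  have h3 := norm_sub_le ((M.step h fθ)^[S] y - y) (flow f (S * h) y - y)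
  rw [sub_sub_sub_cancel_right] at h3
  exact h3.trans (add_le_add h1 h2)

/-- The error bound with explicit constants, for fields on a complex Banach space. The comparison of
`norm_sub_le_of_iterate_step` is applied on `p` concentric balls whose radii differ by `r₁ / p`;
each application gains a factor `O(h)`. -/
theorem norm_sub_le_learningLoss (M : RungeKutta s) (hM : M.IsConsistent) {p S : ℕ} (hp : 1 ≤ p)
    (hS : 1 ≤ S) {f fθ δ : E → E} {x : E} {r₁ r₂ m h : ℝ} (hr₁ : 0 < r₁) (hr₂ : 0 < r₂) (hm : 0 < m)
    (hf : AnalyticOnNhd ℂ f (Metric.ball x (r₁ + r₂)))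
    (hfθ : AnalyticOnNhd ℂ fθ (Metric.ball x (r₁ + r₂)))
    (hb : ∀ u ∈ Metric.ball x (r₁ + r₂), ‖f u‖ ≤ m)
    (hbθ : ∀ u ∈ Metric.ball x (r₁ + r₂), ‖fθ u‖ ≤ m)
    (hδ : HasLocalError M.step f (Metric.ball x (r₁ + r₂)) p δ) (hh : 0 < h)
    (hκ₁ : 144 * (S * (M.stageBound * M.weightBound ^ 2)) * (h * m) ≤ r₁ / p)
    (hκ₂ : 16 * (S * (M.stageBound * M.weightBound)) * (h * m) < r₂) :
    ‖fθ x - f x‖ ≤ Real.exp 1 / (Real.exp 1 - 1) * (learningLoss M.step f fθ S h x r₁ +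
        2 * (m * ((2 * M.weightBound * (16 * M.stageBound) ^ p + (4 * (p + 1)) ^ p)
          * (m / (r₂ / 2)) ^ p) * h ^ p)) +
      (48 * (S * (M.stageBound * M.weightBound ^ 2)) * (h * m / (r₁ / p))) ^ p * (2 * m) := by
  have hα := M.one_le_stageBound
  have hβ := M.one_le_weightBound
  have hS1 : (1 : ℝ) ≤ S := by exact_mod_cast hS
  have hp0 : (0 : ℝ) < p := by exact_mod_cast hp
  have hhm : 0 < h * m := by positivity
  set η := r₁ / p with hη
  have hη0 : 0 < η := by positivity
  have hηp : p * η = r₁ := by rw [hη]; field_simp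
  set q := 48 * (S * (M.stageBound * M.weightBound ^ 2)) * (h * m / η) with hq
  have hq0 : 0 ≤ q := by positivity
  have hq3 : q ≤ 1 / 3 := by
    rw [hq, mul_div_assoc', div_le_iff₀ hη0]
    linarith
  set A := learningLoss M.step f fθ S h x r₁ +
    2 * (m * ((2 * M.weightBound * (16 * M.stageBound) ^ p + (4 * (p + 1)) ^ p)
      * (m / (r₂ / 2)) ^ p) * h ^ p) with hA
  have hbdd := M.bddAbove_solverErrors hr₂ hm hf hfθ hb hbθ hδ hh hS hκ₂
  have hSh : 0 < S * h := by positivity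
  -- The loss bounds the difference of the iterates at every point of `B(x, r₁)`.
  have hAle : ∀ y ∈ Metric.ball x r₁,
      ‖(M.step h fθ)^[S] y - (M.step h f)^[S] y‖ / (S * h) ≤ A := by
    intro y hy
    have hsub : Metric.ball y r₂ ⊆ Metric.ball x (r₁ + r₂) :=
      Metric.ball_subset_ball' (by rw [Metric.mem_ball] at hy; linarith)
    have h1 : ‖(M.step h fθ)^[S] y - flow f (S * h) y‖ ≤ sSup (solverErrors M.step f fθ S h x r₁) :=
      le_csSup hbdd ⟨y, hy, rfl⟩
    have h2 := (M.norm_iterate_step_sub_flow_le hr₂ hm (fun u hu => hf u (hsub hu))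
      (fun u hu => hb u (hsub hu)) hδ hsub hh hS hκ₂).1
    have h3 := norm_sub_le ((M.step h fθ)^[S] y - flow f (S * h) y)
      ((M.step h f)^[S] y - flow f (S * h) y)
    rw [sub_sub_sub_cancel_right] at h3
    rw [div_le_iff₀ hSh, hA, learningLoss, add_mul, div_mul_cancel₀ _ hSh.ne']
    refine h3.trans (add_le_add h1 (h2.trans_eq ?_))
    ring
  have hA0 : 0 ≤ A := (by positivity : (0 : ℝ) ≤ _).trans (hAle x (Metric.mem_ball_self hr₁))
  have he : (2.7182818283 : ℝ) < Real.exp 1 := Real.exp_one_gt_d9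
  have he' : Real.exp 1 < 3 := Real.exp_one_lt_d9.trans (by norm_num)
  set c := Real.exp 1 / (Real.exp 1 - 1) with hc
  have hc0 : 0 ≤ c := div_nonneg (by linarith) (by linarith)
  -- The geometric series with ratio `q ≤ 1 / e` sums to at most `e / (e - 1)`.
  have hqc : 1 + q * c ≤ c := by
    have h1 : q * Real.exp 1 ≤ 1 := by
      calc q * Real.exp 1 ≤ 1 / 3 * 3 := by gcongr
        _ = 1 := by norm_num
    rw [hc, mul_div_assoc', one_add_div (by linarith), div_le_div_iff_of_pos_right (by linarith)]
    linarith
  have hκη : 16 * (S * (M.stageBound * M.weightBound)) * (h * m) ≤ η := by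
    refine le_trans ?_ hκ₁
    have : M.weightBound ≤ M.weightBound ^ 2 := by nlinarith
    gcongr
    norm_num
  have key : ∀ j : ℕ, j ≤ p → ∀ y ∈ Metric.closedBall x ((p - j) * η),
      ‖fθ y - f y‖ ≤ A * c + q ^ j * (2 * m) := by
    intro j
    induction j with
    | zero =>
      intro _ y hy
      have hy' : y ∈ Metric.ball x (r₁ + r₂) := by
        refine Metric.closedBall_subset_ball ?_ hy
        rw [Nat.cast_zero, sub_zero, hηp]
        linarith
      have h1 := norm_sub_le (fθ y) (f y)
      have h2 := hb y hy'
      have h3 := hbθ y hy'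
      have : 0 ≤ A * c := by positivity
      rw [pow_zero]
      linarith
    | succ j ih =>
      intro hj y hy
      have ih := ih (by omega)
      have hjη : (0 : ℝ) ≤ j * η := by positivity
      rw [Metric.mem_closedBall] at hy
      push_cast at hy
      have hsub : Metric.ball y η ⊆ Metric.closedBall x ((p - j) * η) := fun u hu => by
        rw [Metric.mem_ball] at hu
        rw [Metric.mem_closedBall]
        linarith [dist_triangle u y x]
      have hsub' : Metric.ball y η ⊆ Metric.ball x (r₁ + r₂) :=
        hsub.trans (Metric.closedBall_subset_ball (by linarith))
      have hyr : y ∈ Metric.ball x r₁ := by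
        rw [Metric.mem_ball]
        linarith
      have h1 := M.norm_sub_le_of_iterate_step hM hη0 hm (hf.differentiableOn.mono hsub')
        (hfθ.differentiableOn.mono hsub') (fun u hu => hb u (hsub' hu))
        (fun u hu => hbθ u (hsub' hu)) (fun u hu => ih u (hsub hu)) hh hS hκη
      rw [← hq] at h1
      calc ‖fθ y - f y‖ ≤ A + q * (A * c + q ^ j * (2 * m)) :=
            h1.trans (add_le_add (hAle y hyr) le_rfl)
        _ = A * (1 + q * c) + q ^ (j + 1) * (2 * m) := by ring
        _ ≤ A * c + q ^ (j + 1) * (2 * m) := by gcongr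
  have := key p le_rfl x (by simp)
  linarith

/-- The constants of the error bound depend only on the method, on `p`, `S`, and on the ratios of
the radii to the bound of the fields. -/
theorem exists_error_bound (M : RungeKutta s) (hM : M.IsConsistent) {p S : ℕ} {ρ₁ ρ₂ : ℝ}
    (hp : 1 ≤ p) (hS : 1 ≤ S) (hρ₁ : 0 < ρ₁) (hρ₂ : 0 < ρ₂) :
    ∃ T₀ c₂ : ℝ, 0 < T₀ ∧ 0 < c₂ ∧
      ∀ (D : ℕ) (x : Fin D → ℂ) (r₁ r₂ m : ℝ) (f fθ δ : (Fin D → ℂ) → (Fin D → ℂ)),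
        0 < r₁ → 0 < r₂ → 0 < m → r₁ / m = ρ₁ → r₂ / m = ρ₂ →
        AnalyticOnNhd ℂ f (Metric.ball x (r₁ + r₂)) →
        AnalyticOnNhd ℂ fθ (Metric.ball x (r₁ + r₂)) →
        (∀ y ∈ Metric.ball x (r₁ + r₂), ‖f y‖ ≤ m) →
        (∀ y ∈ Metric.ball x (r₁ + r₂), ‖fθ y‖ ≤ m) →
        HasLocalError M.step f (Metric.ball x (r₁ + r₂)) p δ →
        ∀ T h : ℝ, 0 < T → T < T₀ → h = T / S →
          BddAbove (solverErrors M.step f fθ S h x r₁) ∧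
          ‖fθ x - f x‖ ≤ c₂ * m * h ^ p +
            Real.exp 1 / (Real.exp 1 - 1) * learningLoss M.step f fθ S h x r₁ := by
  have hα := M.one_le_stageBound
  have hβ := M.one_le_weightBound
  have hS1 : (1 : ℝ) ≤ S := by exact_mod_cast hS
  have hp0 : (0 : ℝ) < p := by exact_mod_cast hp
  have he : (0 : ℝ) < Real.exp 1 - 1 := by linarith [Real.add_one_lt_exp (one_ne_zero (α := ℝ))]
  set c := Real.exp 1 / (Real.exp 1 - 1) with hc
  have hc0 : 0 < c := by positivity
  set B₁ := 144 * (S * (M.stageBound * M.weightBound ^ 2)) with hB₁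
  set B₂ := 16 * (S * (M.stageBound * M.weightBound)) with hB₂
  have hB₁0 : 0 < B₁ := by positivity
  have hB₂0 : 0 < B₂ := by positivity
  set C₁ := 2 * M.weightBound * (16 * M.stageBound) ^ p + (4 * (p + 1)) ^ p with hC₁
  refine ⟨min (ρ₁ / (p * B₁)) (ρ₂ / B₂),
    c * (2 * (C₁ * (2 / ρ₂) ^ p)) + (B₁ / 3 * (p / ρ₁)) ^ p * 2, by positivity, by positivity, ?_⟩
  intro D x r₁ r₂ m f fθ δ hr₁ hr₂ hm h₁ h₂ hf hfθ hb hbθ hδ T h hT hTT₀ hhT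
  have hh : 0 < h := by rw [hhT]; positivity
  have hhle : h ≤ T := by rw [hhT]; exact div_le_self hT.le hS1
  have hlt := lt_of_le_of_lt hhle hTT₀
  have hlt₁ := hlt.trans_le (min_le_left _ _)
  have hlt₂ := hlt.trans_le (min_le_right _ _)
  rw [lt_div_iff₀ (by positivity)] at hlt₁ hlt₂
  have hr₁m : r₁ = ρ₁ * m := by rw [← h₁]; field_simp
  have hr₂m : r₂ = ρ₂ * m := by rw [← h₂]; field_simp
  have hκ₁ : B₁ * (h * m) ≤ r₁ / p := by
    rw [le_div_iff₀ hp0, hr₁m]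
    have := mul_le_mul_of_nonneg_right hlt₁.le hm.le
    linarith
  have hκ₂ : B₂ * (h * m) < r₂ := by
    rw [hr₂m]
    have := mul_lt_mul_of_pos_right hlt₂ hm
    linarith
  refine ⟨M.bddAbove_solverErrors hr₂ hm hf hfθ hb hbθ hδ hh hS hκ₂, ?_⟩
  have key := M.norm_sub_le_learningLoss hM hp hS hr₁ hr₂ hm hf hfθ hb hbθ hδ hh hκ₁ hκ₂
  rw [← hC₁, ← hc] at key
  refine key.trans_eq ?_
  have e1 : m / (r₂ / 2) = 2 / ρ₂ := by rw [hr₂m]; field_simp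
  have e2 : 48 * (S * (M.stageBound * M.weightBound ^ 2)) * (h * m / (r₁ / p))
      = (B₁ / 3 * (p / ρ₁)) * h := by rw [hr₁m, hB₁]; field_simp; ring
  rw [e1, e2, mul_pow _ h]
  ring

end RungeKutta

theorem theorem3p2 :
    -- the IMDE of a consistent one-step integrator of order `p`
    (∀ (E : Type) [NormedAddCommGroup E] [NormedSpace ℝ E] [FiniteDimensional ℝ E]
        (Φ : OneStepMethod E), IsConsistentIntegrator Φ →
      ∀ (U : Set E) (f δ : E → E) (p : ℕ), IsOpen U → ContDiffOn ℝ ∞ f U → 1 ≤ p →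
        HasLocalError Φ f U p δ →
        (∃ F : ℕ → E → E, IsIMDE Φ f U F) ∧
        ∀ F : ℕ → E → E, IsIMDE Φ f U F →
          EqOn (F 0) f U ∧
          (∀ k, 1 ≤ k → k < p → EqOn (F k) 0 U) ∧
          EqOn (F p) (-δ) U ∧
          ∀ K : ℕ, ∀ y ∈ U, (fun h : ℝ => truncField F K h y - f y)
            =O[𝓝[>] (0 : ℝ)] (fun h : ℝ => h ^ p)) ∧
    -- consistent Runge–Kutta methods are integrators of this kind
    (∀ (E : Type) [NormedAddCommGroup E] [NormedSpace ℝ E] [FiniteDimensional ℝ E]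
        (s : ℕ) (M : RungeKutta s), M.IsConsistent →
      IsConsistentIntegrator (M.step : OneStepMethod E)) ∧
    -- the error bound; vectors of `Fin D → ℂ` carry the maximum norm
    (∀ (s : ℕ) (M : RungeKutta s), M.IsConsistent →
      ∀ (p S : ℕ) (ρ₁ ρ₂ : ℝ), 1 ≤ p → 1 ≤ S → 0 < ρ₁ → 0 < ρ₂ →
      ∃ T₀ c₂ : ℝ, 0 < T₀ ∧ 0 < c₂ ∧
        ∀ (D : ℕ) (x : Fin D → ℝ) (r₁ r₂ m : ℝ) (f fθ δ : (Fin D → ℂ) → (Fin D → ℂ)),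
          0 < r₁ → 0 < r₂ → 0 < m → r₁ / m = ρ₁ → r₂ / m = ρ₂ →
          AnalyticOnNhd ℂ f (Metric.ball (complexPoint x) (r₁ + r₂)) →
          AnalyticOnNhd ℂ fθ (Metric.ball (complexPoint x) (r₁ + r₂)) →
          (∀ y ∈ Metric.ball (complexPoint x) (r₁ + r₂), ‖f y‖ ≤ m) →
          (∀ y ∈ Metric.ball (complexPoint x) (r₁ + r₂), ‖fθ y‖ ≤ m) →
          HasLocalError M.step f (Metric.ball (complexPoint x) (r₁ + r₂)) p δ →
          ∀ T h : ℝ, 0 < T → T < T₀ → h = T / S →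
            BddAbove (solverErrors M.step f fθ S h (complexPoint x) r₁) ∧
            ‖fθ (complexPoint x) - f (complexPoint x)‖ ≤
              c₂ * m * h ^ p +
                Real.exp 1 / (Real.exp 1 - 1) *
                  learningLoss M.step f fθ S h (complexPoint x) r₁) := by
  refine ⟨?_, ?_, ?_⟩
  · intro E _ _ _ Φ hΦ U f δ p hU hf hp hδ
    exact ⟨⟨imdeCoeff Φ f, isIMDE_imdeCoeff hΦ hU hf⟩, fun F hF =>
      ⟨hF.eqOn_zero hΦ hU hf, hF.eqOn_zero_of_lt hΦ hU hf hδ,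
        hF.eqOn_neg_localError hΦ hU hp hf hδ,
        fun K y hy => hF.truncField_sub_isBigO hΦ hU hf hδ K hy⟩⟩
  · intro E _ _ _ s M hM
    exact RungeKutta.isConsistentIntegrator_step hM
  · intro s M hM p S ρ₁ ρ₂ hp hS hρ₁ hρ₂
    obtain ⟨T₀, c₂, hT₀, hc₂, h⟩ := M.exists_error_bound hM hp hS hρ₁ hρ₂
    exact ⟨T₀, c₂, hT₀, hc₂, fun D x => h D (complexPoint x)⟩
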